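/- Let $N,m$ be positive integers and $\kappa\in\mathbb C$. Write $\sigma_{pq}\in S_N$ for the transposition of $p\ne q$ and $\sigma_p=\sigma_{p,p+1}$. The trigonometric Cherednik algebra $T_N$ is the complex associative unital algebra generated by the group algebra $\mathbb C S_N$, the Laurent polynomial ring $\mathbb C[x_1^{\pm1},\dots,x_N^{\pm1}]$ and pairwise commuting elements $u_1,\dots,u_N$, subject to the relations $\sigma_p u_q=u_q\sigma_p$ for $q\ne p,p+1$, $\ \sigma_p u_p=u_{p+1}\sigma_p-1$, $\ \sigma x_p\sigma^{-1}=x_{\sigma(p)}$ for $\sigma\in S_N$, and, with $z_p=u_p-\sum_{r<p}\sigma_{rp}$, $$[z_p,x_q]=-x_p\sigma_{pq}\ (q\ne p),\qquad [z_p,x_p]=\kappa x_p+\sum_{r\ne p}x_p\sigma_{pr}.$$ Let $E_{ab}$ be the matrix units of $\mathfrak{gl}_m$, and let $\widehat{\mathfrak{gl}}_m=\mathfrak{gl}_m[t,t^{-1}]\oplus\mathbb C\,C$ be the affine Lie algebra, where $C$ is central and $[Xt^i,Yt^j]=[X,Y]t^{i+j}+i\,\delta_{i,-j}\,\mathrm{tr}(XY)\,C$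 for $X,Y\in\mathfrak{gl}_m$, $i,j\in\mathbb Z$. Let $V$ be a $\widehat{\mathfrak{gl}}_m$-module such that every vector of $V$ is annihilated by $t^i\,\mathfrak{gl}_m[t]$ for some $i$ depending on the vector. Put $$W=\mathbb C[x_1^{\pm1},\dots,x_N^{\pm1}]\otimes(\mathbb C^m)^{\otimes N}\otimes V .$$ For $X\in\mathfrak{gl}_m$ let $X^{(p)}$ denote $X$ acting on the $p$-th tensor factor $\mathbb C^m$. Then $W$ is a $\widehat{\mathfrak{gl}}_m$-module on which $Xt^j$ acts as $\sum_{q=1}^N x_q^j\otimes X^{(q)}\otimes\mathrm{id}+\mathrm{id}\otimes\mathrm{id}\otimes Xt^j$ and $C$ acts as $\mathrm{id}\otimes\mathrm{id}\otimes C$. The Cherednik operators on $W$ are, for $p=1,\dots,N$, $$\kappa\,x_p\partial_p\otimes\mathrm{id}\otimes\mathrm{id}+\sum_{r\ne p}\frac{x_p}{x_p-x_r}(1-\sigma_{pr})\otimes\sigma_{pr}\otimes\mathrm{id}+\sum_{i=0}^\infty\sum_{a,b=1}^m x_p^{-i}\otimes E_{ab}^{(p)}\otimes E_{ba}t^i ,$$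 where $\partial_p=\partial/\partial x_p$, $S_N$ acts on Laurent polynomials by permuting the variables and on $(\mathbb C^m)^{\otimes N}$ by permuting the tensor factors; the sum over $i$ is finite on every vector. Then: (i) There is an action of $T_N$ on $W$ in which $x_p$ and $x_p^{-1}$ act by multiplication in $\mathbb C[x_1^{\pm1},\dots,x_N^{\pm1}]$, each $\sigma\in S_N$ acts by simultaneous permutation of the variables $x_1,\dots,x_N$ and of the $N$ tensor factors $\mathbb C^m$, and $z_p$ acts as the $p$-th Cherednik operator. (ii) This action of $T_N$ on $W$ commutes with the action of the Lie subalgebra $\mathfrak{gl}_m=\mathfrak{gl}_m t^0\subset\widehat{\mathfrak{gl}}_m$. (iii) If $V$ has level $\kappa-m$, that is, if $C$ acts on $V$ as the scalar $\kappa-m$, then the action of $T_N$ preserves the subspace $\mathfrak q\,W\subset W$ spanned by the vectors $Zw$ with $Z\in\mathfrak q$ and $w\in W$, where $\mathfrak q=t^{-1}\mathfrak{sl}_m[t^{-1}]\subset\widehat{\mathfrak{gl}}_m$. -/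

import Mathlib

open scoped TensorProduct

noncomputable section

namespace TrigCherednik

attribute [local instance 100] LieRing.ofAssociativeRing

/-! ### The trigonometric Cherednik algebra -/

/-- Generators: the permutations, the elements `x p`, their inverses, and the elements `u p` of the
degenerate affine Hecke algebra. -/
inductive Gen (N : ℕ) : Type
  | perm (σ : Equiv.Perm (Fin N)) : Gen N
  | x (p : Fin N) : Gen N
  | xInv (p : Fin N) : Gen N
  | u (p : Fin N) : Gen N

namespace Pre

variable {N : ℕ}

/-- A permutation as an element of the free algebra. -/
def s (σ : Equiv.Perm (Fin N)) : FreeAlgebra ℂ (Gen N) := FreeAlgebra.ι ℂ (Gen.perm σ)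

/-- The generator `x p` in the free algebra. -/
def x (p : Fin N) : FreeAlgebra ℂ (Gen N) := FreeAlgebra.ι ℂ (Gen.x p)

/-- The generator `xInv p` in the free algebra. -/
def xInv (p : Fin N) : FreeAlgebra ℂ (Gen N) := FreeAlgebra.ι ℂ (Gen.xInv p)

/-- The generator `u p` in the free algebra. -/
def u (p : Fin N) : FreeAlgebra ℂ (Gen N) := FreeAlgebra.ι ℂ (Gen.u p)

/-- `z p = u p - ∑_{r < p} σ_{rp}`. -/
def z (p : Fin N) : FreeAlgebra ℂ (Gen N) :=
  u p - ∑ r ∈ Finset.univ.filter (fun r => r < p), s (Equiv.swap r p)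

end Pre

open Pre in
/-- The defining relations of the trigonometric Cherednik algebra with parameter `κ`: those of the
symmetric group, of the Laurent polynomial ring, of the degenerate affine Hecke algebra, and the
cross relations between the last two. -/
inductive Rel (N : ℕ) (κ : ℂ) : FreeAlgebra ℂ (Gen N) → FreeAlgebra ℂ (Gen N) → Prop
  | perm_one : Rel N κ (s 1) 1
  | perm_mul (σ τ : Equiv.Perm (Fin N)) : Rel N κ (s (σ * τ)) (s σ * s τ)
  | x_comm (p q : Fin N) : Rel N κ (x p * x q) (x q * x p)
  | x_mul_xInv (p : Fin N) : Rel N κ (x p * xInv p) 1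
  | xInv_mul_x (p : Fin N) : Rel N κ (xInv p * x p) 1
  | u_comm (p q : Fin N) : Rel N κ (u p * u q) (u q * u p)
  | perm_u_far (p p' q : Fin N) (hp : (p' : ℕ) = p + 1) (hq : q ≠ p) (hq' : q ≠ p') :
      Rel N κ (s (Equiv.swap p p') * u q) (u q * s (Equiv.swap p p'))
  | perm_u_near (p p' : Fin N) (hp : (p' : ℕ) = p + 1) :
      Rel N κ (s (Equiv.swap p p') * u p) (u p' * s (Equiv.swap p p') - 1)
  | perm_x (σ : Equiv.Perm (Fin N)) (p : Fin N) : Rel N κ (s σ * x p * s σ⁻¹) (x (σ p))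
  | z_x_ne (p q : Fin N) (h : q ≠ p) :
      Rel N κ (z p * x q - x q * z p) (-(x p * s (Equiv.swap p q)))
  | z_x_self (p : Fin N) :
      Rel N κ (z p * x p - x p * z p)
        (κ • x p + ∑ r ∈ Finset.univ.filter (fun r => r ≠ p), x p * s (Equiv.swap p r))

/-- The trigonometric Cherednik algebra `T_N` with parameter `κ`. -/
abbrev Alg (N : ℕ) (κ : ℂ) : Type := RingQuot (Rel N κ)

namespace Alg

variable {N : ℕ} (κ : ℂ)

/-- The element of `T_N` given by a permutation. -/
def s (σ : Equiv.Perm (Fin N)) : Alg N κ := RingQuot.mkAlgHom ℂ (Rel N κ) (Pre.s σ)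

/-- The element `x_p` of `T_N`. -/
def x (p : Fin N) : Alg N κ := RingQuot.mkAlgHom ℂ (Rel N κ) (Pre.x p)

/-- The element `x_p⁻¹` of `T_N`. -/
def xInv (p : Fin N) : Alg N κ := RingQuot.mkAlgHom ℂ (Rel N κ) (Pre.xInv p)

/-- The element `z_p` of `T_N`. -/
def z (p : Fin N) : Alg N κ := RingQuot.mkAlgHom ℂ (Rel N κ) (Pre.z p)

end Alg

/-! ### The affine Lie algebra of `gl_m` -/

/-- The Lie algebra `gl_m` of complex `m × m` matrices. -/
abbrev Mat (m : ℕ) : Type := Matrix (Fin m) (Fin m) ℂ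

/-- The bilinear form `(X, Y) ↦ -tr (X Y)`. The sign is there because Mathlib's `residuePairing`
carries the second exponent where the usual cocycle carries the first. -/
def negTraceForm (m : ℕ) : LinearMap.BilinForm ℂ (Mat m) :=
  -((LinearMap.mul ℂ (Mat m)).compr₂ (Matrix.traceLinearMap (Fin m) ℂ ℂ))

theorem negTraceForm_apply (m : ℕ) (X Y : Mat m) :
    negTraceForm m X Y = -Matrix.trace (X * Y) := rfl

theorem negTraceForm_isSymm (m : ℕ) : (negTraceForm m).IsSymm := by
  refine ⟨fun X Y => ?_⟩
  simp [negTraceForm_apply, Matrix.trace_mul_comm X Y]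

theorem negTraceForm_lieInvariant (m : ℕ) : (negTraceForm m).lieInvariant (Mat m) := by
  intro X Y Z
  simp only [negTraceForm_apply, Ring.lie_def, sub_mul, mul_sub, Matrix.trace_sub]
  rw [Matrix.mul_assoc X Y Z, Matrix.trace_mul_comm X (Y * Z), Matrix.mul_assoc Y X Z,
    Matrix.mul_assoc Y Z X]
  ring

/-- The 2-cocycle `(X t^i, Y t^j) ↦ i δ_{i,-j} tr (X Y)` on `gl_m[t, t⁻¹]`. -/
def cocycle (m : ℕ) := LieAlgebra.LoopAlgebra.twoCocycleOfBilinear ℂ ℤ (Mat m) (negTraceForm m)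
  (negTraceForm_lieInvariant m) (negTraceForm_isSymm m)

/-- The affine Lie algebra: the central extension of the loop algebra `gl_m[t, t⁻¹]` by a line. -/
abbrev Affine (m : ℕ) : Type := LieAlgebra.ofTwoCocycle (cocycle m)

/-- The element `X t^j`. -/
def cur {m : ℕ} (X : Mat m) (j : ℤ) : Affine m :=
  LieAlgebra.ofProd (cocycle m) (AddMonoidAlgebra.single j (1 : ℂ) ⊗ₜ[ℂ] X, 0)

/-- The central element `C`. -/
def cen (m : ℕ) : Affine m :=
  LieAlgebra.ofProd (cocycle m) (0, (TrivialLieModule.equiv ℂ _ ℂ).symm 1)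

/-- The matrix unit `E_{ab}`. -/
abbrev E {m : ℕ} (a b : Fin m) : Mat m := Matrix.single a b 1

theorem lie_cur {m : ℕ} (X Y : Mat m) (i j : ℤ) :
    ⁅cur X i, cur Y j⁆ = cur (X * Y - Y * X) (i + j)
      + (if i = -j then (i : ℂ) * Matrix.trace (X * Y) else 0) • cen m := by
  have hc : ((cocycle m).1.1 (AddMonoidAlgebra.single i (1 : ℂ) ⊗ₜ[ℂ] X))
      (AddMonoidAlgebra.single j (1 : ℂ) ⊗ₜ[ℂ] Y) = (TrivialLieModule.equiv ℂ _ ℂ).symm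
        (if i = -j then (i : ℂ) * Matrix.trace (X * Y) else 0) := by
    change (TrivialLieModule.equiv ℂ _ ℂ).symm (LieAlgebra.LoopAlgebra.residuePairing ℂ ℤ (Mat m)
      (negTraceForm m) _ _) = _
    congr 1
    rw [LieAlgebra.LoopAlgebra.residuePairing_apply_apply,
      LieAlgebra.LoopAlgebra.toFinsupp_single_tmul, LieAlgebra.LoopAlgebra.toFinsupp_single_tmul,
      Finsupp.sum_single_index (by simp)]
    by_cases h : i = -j
    · subst h
      simp [negTraceForm_apply]
    · simp [h]
  rw [LieAlgebra.bracket_ofTwoCocycle]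
  simp only [cur, cen, ← LieAlgebra.of_smul, ← LieAlgebra.of_add]
  refine Equiv.congr_arg (Prod.ext ?_ ?_)
  · simp only [Equiv.symm_apply_apply, LieAlgebra.ExtendScalars.bracket_tmul, Ring.lie_def,
      AddMonoidAlgebra.single_mul_single, mul_one, Prod.smul_mk, smul_zero, Prod.mk_add_mk,
      add_zero]
  · simp only [Equiv.symm_apply_apply]
    refine (congrArg₂ (· - ·) (congrArg₂ (· + ·) hc (lie_zero _)) (lie_zero _)).trans ?_
    by_cases h : i = -j
    · rw [if_pos h, Prod.snd_add, Prod.smul_snd, ← map_smul, smul_eq_mul, mul_one, sub_zero,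
        add_zero, zero_add]
    · rw [if_neg h, Prod.snd_add, Prod.smul_snd, map_zero, zero_smul, sub_zero]

theorem lie_cen {m : ℕ} (Z : Affine m) : ⁅cen m, Z⁆ = 0 := by
  rw [LieAlgebra.bracket_ofTwoCocycle]
  simp only [cen, ← LieAlgebra.of_zero]
  refine Equiv.congr_arg (Prod.ext ?_ ?_)
  · simp
  · simp [LieModule.IsTrivial.trivial]

/-! ### The space `W` -/

/-- Laurent polynomials in `x_1, …, x_N`. -/
abbrev Laurent (N : ℕ) : Type := AddMonoidAlgebra ℂ (Fin N → ℤ)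

/-- The space `(ℂ^m)^{⊗N}`. -/
abbrev Tens (N m : ℕ) : Type := ⨂[ℂ] _ : Fin N, (Fin m → ℂ)

/-- The space `W = ℂ[x_1^{±1}, …, x_N^{±1}] ⊗ (ℂ^m)^{⊗N} ⊗ V`. -/
def W (N m : ℕ) (V : Type*) [AddCommGroup V] [Module ℂ V] : Type _ :=
  Laurent N ⊗[ℂ] (Tens N m ⊗[ℂ] V)

instance (N m : ℕ) (V : Type*) [AddCommGroup V] [Module ℂ V] : AddCommGroup (W N m V) :=
  inferInstanceAs (AddCommGroup (Laurent N ⊗[ℂ] (Tens N m ⊗[ℂ] V)))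

instance (N m : ℕ) (V : Type*) [AddCommGroup V] [Module ℂ V] : Module ℂ (W N m V) :=
  inferInstanceAs (Module ℂ (Laurent N ⊗[ℂ] (Tens N m ⊗[ℂ] V)))

/-- The pure tensor `f ⊗ g ⊗ v`. -/
def W.tmul {N m : ℕ} {V : Type*} [AddCommGroup V] [Module ℂ V] (f : Laurent N) (g : Tens N m)
    (v : V) : W N m V :=
  f ⊗ₜ[ℂ] (g ⊗ₜ[ℂ] v)

theorem W.add_tmul {N m : ℕ} {V : Type*} [AddCommGroup V] [Module ℂ V] (f f' : Laurent N)
    (g : Tens N m) (v : V) : W.tmul (f + f') g v = W.tmul f g v + W.tmul f' g v :=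
  TensorProduct.add_tmul f f' (g ⊗ₜ[ℂ] v)

theorem W.tmul_add_tmul {N m : ℕ} {V : Type*} [AddCommGroup V] [Module ℂ V] (f : Laurent N)
    (g g' : Tens N m) (v : V) : W.tmul f (g + g') v = W.tmul f g v + W.tmul f g' v :=
  (congrArg (f ⊗ₜ[ℂ] ·) (TensorProduct.add_tmul g g' v)).trans (TensorProduct.tmul_add f _ _)

theorem W.tmul_add {N m : ℕ} {V : Type*} [AddCommGroup V] [Module ℂ V] (f : Laurent N)
    (g : Tens N m) (v v' : V) : W.tmul f g (v + v') = W.tmul f g v + W.tmul f g v' :=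
  (congrArg (f ⊗ₜ[ℂ] ·) (TensorProduct.tmul_add g v v')).trans (TensorProduct.tmul_add f _ _)

theorem W.smul_tmul {N m : ℕ} {V : Type*} [AddCommGroup V] [Module ℂ V] (c : ℂ) (f : Laurent N)
    (g : Tens N m) (v : V) : W.tmul (c • f) g v = c • W.tmul f g v :=
  (TensorProduct.smul_tmul' c f (g ⊗ₜ[ℂ] v)).symm

theorem W.tmul_smul_tmul {N m : ℕ} {V : Type*} [AddCommGroup V] [Module ℂ V] (c : ℂ) (f : Laurent N)
    (g : Tens N m) (v : V) : W.tmul f (c • g) v = c • W.tmul f g v :=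
  (congrArg (f ⊗ₜ[ℂ] ·) (TensorProduct.smul_tmul' c g v).symm).trans (TensorProduct.tmul_smul c f _)

theorem W.tmul_smul {N m : ℕ} {V : Type*} [AddCommGroup V] [Module ℂ V] (c : ℂ) (f : Laurent N)
    (g : Tens N m) (v : V) : W.tmul f g (c • v) = c • W.tmul f g v :=
  (congrArg (f ⊗ₜ[ℂ] ·) (TensorProduct.tmul_smul c g v)).trans (TensorProduct.tmul_smul c f _)

theorem W.tmul_zero {N m : ℕ} {V : Type*} [AddCommGroup V] [Module ℂ V] (f : Laurent N)
    (g : Tens N m) : W.tmul f g (0 : V) = 0 :=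
  (congrArg (f ⊗ₜ[ℂ] ·) (TensorProduct.tmul_zero V g)).trans (TensorProduct.tmul_zero _ f)

theorem W.induction {N m : ℕ} {V : Type*} [AddCommGroup V] [Module ℂ V] {P : W N m V → Prop}
    (zero : P 0) (add : ∀ w w', P w → P w' → P (w + w'))
    (tmul : ∀ (f : Laurent N) (g : Tens N m) (v : V), P (W.tmul f g v)) (w : W N m V) : P w := by
  refine TensorProduct.induction_on (motive := P) w zero (fun f y => ?_) add
  refine TensorProduct.induction_on (motive := fun y => P (f ⊗ₜ[ℂ] y)) y ?_ (tmul f) ?_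
  · rw [TensorProduct.tmul_zero]
    exact zero
  · intro y y' hy hy'
    rw [TensorProduct.tmul_add]
    exact add _ _ hy hy'

theorem W.hom_ext {N m : ℕ} {V : Type*} [AddCommGroup V] [Module ℂ V] {φ ψ : Module.End ℂ (W N m V)}
    (h : ∀ f g v, φ (W.tmul f g v) = ψ (W.tmul f g v)) : φ = ψ :=
  LinearMap.ext fun w => W.induction (P := fun w => φ w = ψ w) (by rw [map_zero, map_zero])
    (fun w w' hw hw' => by rw [map_add, map_add, hw, hw']) h w

/-- The monomial `x_p^j`. -/
def xpow {N : ℕ} (p : Fin N) (j : ℤ) : Laurent N := AddMonoidAlgebra.single (Pi.single p j) 1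

/-- Multiplication by `x_p^j`. -/
def mulX {N : ℕ} (p : Fin N) (j : ℤ) : Module.End ℂ (Laurent N) :=
  LinearMap.mulLeft ℂ (xpow p j)

/-- The permutation of the variables `x_p ↦ x_{σ p}`. -/
def varPerm {N : ℕ} (σ : Equiv.Perm (Fin N)) : Laurent N →ₐ[ℂ] Laurent N :=
  AddMonoidAlgebra.mapDomainAlgHom ℂ ℂ
    { toFun := fun k => k ∘ σ.symm, map_zero' := rfl, map_add' := fun _ _ => rfl }

theorem varPerm_single {N : ℕ} (σ : Equiv.Perm (Fin N)) (k : Fin N → ℤ) (c : ℂ) :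
    varPerm σ (AddMonoidAlgebra.single k c) = AddMonoidAlgebra.single (k ∘ σ.symm) c := by
  simp [varPerm]

theorem varPerm_xpow {N : ℕ} (σ : Equiv.Perm (Fin N)) (p : Fin N) (j : ℤ) :
    varPerm σ (xpow p j) = xpow (σ p) j := by
  rw [xpow, varPerm_single, xpow]
  congr 1
  ext q
  simp [Pi.single_apply, Equiv.symm_apply_eq]

/-- The partial derivative `∂_p`, `x^k ↦ k_p x^{k - e_p}`. -/
def partialX {N : ℕ} (p : Fin N) : Module.End ℂ (Laurent N) :=
  (Finsupp.lsum ℂ fun k : Fin N → ℤ =>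
    (k p : ℂ) • AddMonoidAlgebra.lsingle (R := ℂ) (k - Pi.single p 1)) ∘ₗ
    (AddMonoidAlgebra.coeffLinearEquiv ℂ).toLinearMap

theorem partialX_single {N : ℕ} (p : Fin N) (k : Fin N → ℤ) (c : ℂ) :
    partialX p (AddMonoidAlgebra.single k c)
      = AddMonoidAlgebra.single (k - Pi.single p 1) ((k p : ℂ) * c) := by
  simp [partialX]

theorem xpow_add {N : ℕ} (p : Fin N) (i j : ℤ) :
    (xpow p (i + j) : Laurent N) = xpow p i * xpow p j := by
  simp [xpow, AddMonoidAlgebra.single_mul_single, Pi.single_add]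

theorem xpow_zero {N : ℕ} (p : Fin N) : (xpow p 0 : Laurent N) = 1 := by
  simp [xpow, AddMonoidAlgebra.one_def]

theorem dvd_sub_varPerm {N : ℕ} (p r : Fin N) (f : Laurent N) :
    xpow p 1 - xpow r 1 ∣ f - varPerm (Equiv.swap p r) f := by
  induction f using AddMonoidAlgebra.induction_linear with
  | zero => simp
  | add f g hf hg =>
    rw [map_add, add_sub_add_comm]
    exact dvd_add hf hg
  | single k c =>
    rw [varPerm_single, ← Ideal.mem_span_singleton, ← Ideal.Quotient.eq]
    set I : Ideal (Laurent N) := Ideal.span {xpow p 1 - xpow r 1} with hI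
    have hpr : ∀ j : ℤ, Ideal.Quotient.mk I (xpow p j) = Ideal.Quotient.mk I (xpow r j) := by
      have h1 : Ideal.Quotient.mk I (xpow p 1) = Ideal.Quotient.mk I (xpow r 1) :=
        Ideal.Quotient.eq.mpr (Ideal.mem_span_singleton_self _)
      have h2 : ∀ q : Fin N, Ideal.Quotient.mk I (xpow q 1) * Ideal.Quotient.mk I (xpow q (-1)) = 1 := by
        intro q
        rw [← map_mul, ← xpow_add, add_neg_cancel, xpow_zero, map_one]
      have h3 : Ideal.Quotient.mk I (xpow p (-1)) = Ideal.Quotient.mk I (xpow r (-1)) := by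
        have := h2 p
        rw [h1] at this
        exact left_inv_eq_right_inv (by rw [mul_comm]; exact this) (h2 r)
      intro j
      induction j using Int.induction_on with
      | zero => rw [xpow_zero, xpow_zero]
      | succ j ih => rw [xpow_add, xpow_add, map_mul, map_mul, ih, h1]
      | pred j ih => rw [sub_eq_add_neg, xpow_add, xpow_add, map_mul, map_mul, ih, h3]
    have hsum : ∀ (k : Fin N → ℤ), (AddMonoidAlgebra.single k c : Laurent N)
        = AddMonoidAlgebra.single 0 c * ∏ q, xpow q (k q) := by
      intro k
      have h4 : ∀ t : Finset (Fin N), ∏ q ∈ t, (xpow q (k q) : Laurent N)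
          = AddMonoidAlgebra.single (∑ q ∈ t, Pi.single q (k q)) 1 := by
        intro t
        induction t using Finset.induction_on with
        | empty => simp [AddMonoidAlgebra.one_def]
        | insert a t ha ih =>
          rw [Finset.prod_insert ha, Finset.sum_insert ha, ih, xpow,
            AddMonoidAlgebra.single_mul_single, mul_one]
      rw [h4, Finset.univ_sum_single, AddMonoidAlgebra.single_mul_single, zero_add, mul_one]
    rw [hsum, hsum (k ∘ _), map_mul, map_mul, map_prod, map_prod]
    congr 1
    rw [← Equiv.prod_comp (Equiv.swap p r)]
    refine Finset.prod_congr rfl fun q _ => ?_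
    simp only [Function.comp, Equiv.symm_swap]
    rcases eq_or_ne q p with rfl | hp
    · simp [hpr]
    rcases eq_or_ne q r with rfl | hr
    · simp [hpr]
    · simp [Equiv.swap_apply_of_ne_of_ne hp hr]

theorem xpow_sub_ne_zero {N : ℕ} {p r : Fin N} (h : r ≠ p) :
    xpow p 1 - xpow r 1 ≠ (0 : Laurent N) := by
  intro h0
  have h1 := congrArg (fun f : Laurent N => f.coeff (Pi.single p 1)) (sub_eq_zero.mp h0)
  have h2 : (Pi.single r 1 : Fin N → ℤ) ≠ Pi.single p 1 := by
    intro h3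
    have := congrFun h3 r
    simp [h] at this
  simp [xpow, h2] at h1

/-- The operator `(x_p - x_r)⁻¹ (1 - σ_{pr})`: it sends `f` to the unique Laurent polynomial `g`
with `(x_p - x_r) g = f - σ_{pr} f`. -/
def divDiff {N : ℕ} {p r : Fin N} (h : r ≠ p) : Module.End ℂ (Laurent N) where
  toFun f := (dvd_sub_varPerm p r f).choose
  map_add' f g := by
    apply mul_left_cancel₀ (xpow_sub_ne_zero h)
    rw [mul_add, ← (dvd_sub_varPerm p r _).choose_spec, ← (dvd_sub_varPerm p r _).choose_spec,
      ← (dvd_sub_varPerm p r _).choose_spec, map_add]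
    ring
  map_smul' c f := by
    apply mul_left_cancel₀ (xpow_sub_ne_zero h)
    rw [RingHom.id_apply, mul_smul_comm, ← (dvd_sub_varPerm p r _).choose_spec,
      ← (dvd_sub_varPerm p r _).choose_spec, map_smul, smul_sub]

theorem divDiff_spec {N : ℕ} {p r : Fin N} (h : r ≠ p) (f : Laurent N) :
    (xpow p 1 - xpow r 1) * divDiff h f = f - varPerm (Equiv.swap p r) f :=
  (dvd_sub_varPerm p r f).choose_spec.symm

/-- The permutation of the tensor factors: the `i`-th factor goes to position `σ i`. -/
def tensPerm {N : ℕ} (m : ℕ) (σ : Equiv.Perm (Fin N)) : Module.End ℂ (Tens N m) :=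
  (PiTensorProduct.reindex ℂ (fun _ : Fin N => Fin m → ℂ) σ).toLinearMap

theorem tensPerm_tprod {N m : ℕ} (σ : Equiv.Perm (Fin N)) (v : Fin N → Fin m → ℂ) :
    tensPerm m σ (PiTensorProduct.tprod ℂ v) = PiTensorProduct.tprod ℂ (fun i => v (σ.symm i)) := by
  simp [tensPerm]

/-- The operator `X^{(p)}`: the matrix `X` acting on the `p`-th tensor factor. -/
def factorOp {N m : ℕ} (p : Fin N) (X : Mat m) : Module.End ℂ (Tens N m) :=
  PiTensorProduct.map (Function.update (fun _ => LinearMap.id) p (Matrix.toLin' X))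

theorem factorOp_tprod {N m : ℕ} (p : Fin N) (X : Mat m) (v : Fin N → Fin m → ℂ) :
    factorOp p X (PiTensorProduct.tprod ℂ v)
      = PiTensorProduct.tprod ℂ (Function.update v p (X.mulVec (v p))) := by
  rw [factorOp, PiTensorProduct.map_tprod]
  congr 1
  ext1 i
  rcases eq_or_ne i p with rfl | h
  · simp
  · simp [h]

theorem factorOp_add {N m : ℕ} (p : Fin N) (X Y : Mat m) :
    factorOp p (X + Y) = factorOp p X + factorOp p Y := by
  simp only [factorOp, map_add, PiTensorProduct.map_update_add]

theorem factorOp_smul {N m : ℕ} (p : Fin N) (c : ℂ) (X : Mat m) :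
    factorOp p (c • X) = c • factorOp p X := by
  simp only [factorOp, map_smul, PiTensorProduct.map_update_smul]

theorem factorOp_mul {N m : ℕ} (p : Fin N) (X Y : Mat m) :
    factorOp p (X * Y) = factorOp p X * factorOp p Y := by
  refine PiTensorProduct.ext (MultilinearMap.ext fun v => ?_)
  simp [factorOp_tprod, Module.End.mul_apply]

theorem factorOp_commute {N m : ℕ} {p q : Fin N} (h : p ≠ q) (X Y : Mat m) :
    Commute (factorOp p X) (factorOp q Y) := by
  refine PiTensorProduct.ext (MultilinearMap.ext fun v => ?_)
  simp [factorOp_tprod, Module.End.mul_apply, h, h.symm, Function.update_comm h]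

theorem mulLeft_mul_mulLeft {N : ℕ} (f g : Laurent N) :
    LinearMap.mulLeft ℂ f * LinearMap.mulLeft ℂ g = LinearMap.mulLeft ℂ (f * g) :=
  LinearMap.ext fun x => (mul_assoc f g x).symm

section Action

variable {N m : ℕ} {V : Type*} [AddCommGroup V] [Module ℂ V]

/-- The operator `f ⊗ g ⊗ h` on `W`. -/
def op (f : Module.End ℂ (Laurent N)) (g : Module.End ℂ (Tens N m)) (h : Module.End ℂ V) :
    Module.End ℂ (W N m V) :=
  TensorProduct.map f (TensorProduct.map g h)

theorem op_tmul (f : Module.End ℂ (Laurent N)) (g : Module.End ℂ (Tens N m)) (h : Module.End ℂ V)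
    (x : Laurent N) (y : Tens N m) (v : V) :
    op f g h (W.tmul x y v) = W.tmul (f x) (g y) (h v) :=
  (TensorProduct.map_tmul f (TensorProduct.map g h) x (y ⊗ₜ[ℂ] v)).trans
    (congrArg (f x ⊗ₜ[ℂ] ·) (TensorProduct.map_tmul g h y v))

theorem op_mul (f f' : Module.End ℂ (Laurent N)) (g g' : Module.End ℂ (Tens N m))
    (h h' : Module.End ℂ V) :
    (op f g h * op f' g' h' : Module.End ℂ (W N m V)) = op (f * f') (g * g') (h * h') :=
  W.hom_ext fun x y v => by
    rw [Module.End.mul_apply, op_tmul, op_tmul, op_tmul, Module.End.mul_apply, Module.End.mul_apply,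
      Module.End.mul_apply]

theorem op_add_left (f f' : Module.End ℂ (Laurent N)) (g : Module.End ℂ (Tens N m))
    (h : Module.End ℂ V) :
    (op (f + f') g h : Module.End ℂ (W N m V)) = op f g h + op f' g h :=
  W.hom_ext fun x y v => by
    rw [LinearMap.add_apply, op_tmul, op_tmul, op_tmul, LinearMap.add_apply, W.add_tmul]

theorem op_add_mid (f : Module.End ℂ (Laurent N)) (g g' : Module.End ℂ (Tens N m))
    (h : Module.End ℂ V) :
    (op f (g + g') h : Module.End ℂ (W N m V)) = op f g h + op f g' h :=
  W.hom_ext fun x y v => by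
    rw [LinearMap.add_apply, op_tmul, op_tmul, op_tmul, LinearMap.add_apply, W.tmul_add_tmul]

theorem op_add_right (f : Module.End ℂ (Laurent N)) (g : Module.End ℂ (Tens N m))
    (h h' : Module.End ℂ V) :
    (op f g (h + h') : Module.End ℂ (W N m V)) = op f g h + op f g h' :=
  W.hom_ext fun x y v => by
    rw [LinearMap.add_apply, op_tmul, op_tmul, op_tmul, LinearMap.add_apply, W.tmul_add]

theorem op_smul_left (c : ℂ) (f : Module.End ℂ (Laurent N)) (g : Module.End ℂ (Tens N m))
    (h : Module.End ℂ V) :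
    (op (c • f) g h : Module.End ℂ (W N m V)) = c • op f g h :=
  W.hom_ext fun x y v => by
    rw [LinearMap.smul_apply, op_tmul, op_tmul, LinearMap.smul_apply, W.smul_tmul]

theorem op_smul_mid (c : ℂ) (f : Module.End ℂ (Laurent N)) (g : Module.End ℂ (Tens N m))
    (h : Module.End ℂ V) :
    (op f (c • g) h : Module.End ℂ (W N m V)) = c • op f g h :=
  W.hom_ext fun x y v => by
    rw [LinearMap.smul_apply, op_tmul, op_tmul, LinearMap.smul_apply, W.tmul_smul_tmul]

theorem op_smul_right (c : ℂ) (f : Module.End ℂ (Laurent N)) (g : Module.End ℂ (Tens N m))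
    (h : Module.End ℂ V) :
    (op f g (c • h) : Module.End ℂ (W N m V)) = c • op f g h :=
  W.hom_ext fun x y v => by
    rw [LinearMap.smul_apply, op_tmul, op_tmul, LinearMap.smul_apply, W.tmul_smul]

/-- The homomorphism `ℂ[t, t⁻¹] → ℂ[x_1^{±1}, …, x_N^{±1}]`, `t ↦ x_q`. -/
def subst (q : Fin N) : AddMonoidAlgebra ℂ ℤ →ₐ[ℂ] Laurent N :=
  AddMonoidAlgebra.mapDomainAlgHom ℂ ℂ (AddMonoidHom.single (fun _ : Fin N => ℤ) q)

theorem subst_single (q : Fin N) (j : ℤ) :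
    subst q (AddMonoidAlgebra.single j 1) = xpow q j := by
  simp [subst, xpow, -LaurentPolynomial.single_eq_C_mul_T]

/-- The action on `W` of the loop algebra through the `q`-th copy of `ℂ^m[t, t⁻¹]`:
`X t^j ↦ x_q^j ⊗ X^{(q)} ⊗ id`. -/
def loopAction (q : Fin N) : LieAlgebra.loopAlgebra ℂ ℤ (Mat m) →ₗ[ℂ] Module.End ℂ (W N m V) :=
  TensorProduct.lift (LinearMap.mk₂ ℂ
    (fun f X => op (LinearMap.mulLeft ℂ (subst q f)) (factorOp q X) LinearMap.id)
    (fun f f' X => by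
      rw [map_add, ← op_add_left]
      congr 1
      exact LinearMap.ext fun g => add_mul _ _ _)
    (fun c f X => by
      rw [map_smul, ← op_smul_left]
      congr 1
      exact LinearMap.ext fun g => smul_mul_assoc _ _ _)
    (fun f X X' => by rw [factorOp_add, op_add_mid])
    (fun c f X => by rw [factorOp_smul, op_smul_mid]))

theorem loopAction_tmul (q : Fin N) (f : AddMonoidAlgebra ℂ ℤ) (X : Mat m) :
    (loopAction q (f ⊗ₜ[ℂ] X) : Module.End ℂ (W N m V))
      = op (LinearMap.mulLeft ℂ (subst q f)) (factorOp q X) LinearMap.id := rfl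

theorem loopAction_lie (q : Fin N) (a b : LieAlgebra.loopAlgebra ℂ ℤ (Mat m)) :
    (loopAction q ⁅a, b⁆ : Module.End ℂ (W N m V))
      = loopAction q a * loopAction q b - loopAction q b * loopAction q a := by
  induction a using TensorProduct.induction_on with
  | zero =>
    have h : ⁅(0 : LieAlgebra.loopAlgebra ℂ ℤ (Mat m)), b⁆ = 0 := zero_lie b
    rw [h, map_zero, zero_mul, mul_zero, sub_zero]
  | add a a' ha ha' =>
    have h : ⁅(a + a' : LieAlgebra.loopAlgebra ℂ ℤ (Mat m)), b⁆ = ⁅a, b⁆ + ⁅a', b⁆ := add_lie a a' b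
    rw [h, map_add, ha, ha', map_add, add_mul, mul_add]
    abel
  | tmul f X =>
    induction b using TensorProduct.induction_on with
    | zero =>
      have h : ⁅(f ⊗ₜ[ℂ] X : LieAlgebra.loopAlgebra ℂ ℤ (Mat m)),
          (0 : LieAlgebra.loopAlgebra ℂ ℤ (Mat m))⁆ = 0 :=
        lie_zero (L := LieAlgebra.loopAlgebra ℂ ℤ (Mat m)) _
      rw [h, map_zero, zero_mul, mul_zero, sub_zero]
    | add b b' hb hb' =>
      have h : ⁅(f ⊗ₜ[ℂ] X : LieAlgebra.loopAlgebra ℂ ℤ (Mat m)),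
          (b + b' : LieAlgebra.loopAlgebra ℂ ℤ (Mat m))⁆ = ⁅f ⊗ₜ[ℂ] X, b⁆ + ⁅f ⊗ₜ[ℂ] X, b'⁆ :=
        lie_add (L := LieAlgebra.loopAlgebra ℂ ℤ (Mat m)) _ b b'
      rw [h, map_add, hb, hb', map_add, add_mul, mul_add]
      abel
    | tmul g Y =>
      rw [LieAlgebra.ExtendScalars.bracket_tmul, Ring.lie_def, TensorProduct.tmul_sub, map_sub]
      simp only [loopAction_tmul, op_mul, map_mul, factorOp_mul, mulLeft_mul_mulLeft]
      rw [mul_comm (subst q g)]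
      rfl

theorem loopAction_commute {q r : Fin N} (h : q ≠ r) (a b : LieAlgebra.loopAlgebra ℂ ℤ (Mat m)) :
    Commute (loopAction q a : Module.End ℂ (W N m V)) (loopAction r b) := by
  induction a using TensorProduct.induction_on with
  | zero => simp
  | add a a' ha ha' => rw [map_add]; exact ha.add_left ha'
  | tmul f X =>
    induction b using TensorProduct.induction_on with
    | zero => simp
    | add b b' hb hb' => rw [map_add]; exact hb.add_right hb'
    | tmul g Y =>
      rw [loopAction_tmul, loopAction_tmul, Commute, SemiconjBy, op_mul, op_mul,
        (factorOp_commute h X Y).eq, mulLeft_mul_mulLeft, mulLeft_mul_mulLeft,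
        mul_comm (subst q f)]

theorem loopAction_commute_right (q : Fin N) (a : LieAlgebra.loopAlgebra ℂ ℤ (Mat m))
    (φ : Module.End ℂ V) :
    Commute (loopAction q a : Module.End ℂ (W N m V)) (op LinearMap.id LinearMap.id φ) := by
  induction a using TensorProduct.induction_on with
  | zero => simp
  | add a a' ha ha' => rw [map_add]; exact ha.add_left ha'
  | tmul f X =>
    rw [loopAction_tmul, Commute, SemiconjBy, op_mul, op_mul]
    rfl

variable [LieRingModule (Affine m) V] [LieModule ℂ (Affine m) V]

/-- The action of the affine Lie algebra on `W`:
`X t^j ↦ ∑_q x_q^j ⊗ X^{(q)} ⊗ id + id ⊗ id ⊗ X t^j`, and `C ↦ id ⊗ id ⊗ C`. -/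
def affAction : Affine m →ₗ[ℂ] Module.End ℂ (W N m V) where
  toFun Z := ∑ q, loopAction q ((LieAlgebra.ofProd (cocycle m)).symm Z).1
    + op LinearMap.id LinearMap.id (LieModule.toEnd ℂ (Affine m) V Z)
  map_add' Z Z' := by
    simp only [LieAlgebra.of_symm_add, Prod.fst_add, map_add, Finset.sum_add_distrib,
      op_add_right]
    abel
  map_smul' c Z := by
    simp only [LieAlgebra.of_symm_smul, Prod.smul_fst, map_smul, op_smul_right, smul_add, Finset.smul_sum, RingHom.id_apply]

theorem affAction_cur (X : Mat m) (j : ℤ) :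
    (affAction (cur X j) : Module.End ℂ (W N m V))
      = ∑ q, op (mulX q j) (factorOp q X) LinearMap.id
        + op LinearMap.id LinearMap.id (LieModule.toEnd ℂ (Affine m) V (cur X j)) := by
  simp only [mulX, ← subst_single]
  rfl

theorem affAction_cen :
    (affAction (cen m) : Module.End ℂ (W N m V))
      = op LinearMap.id LinearMap.id (LieModule.toEnd ℂ (Affine m) V (cen m)) := by
  simp [affAction, cen]

theorem affAction_lie (Z Z' : Affine m) :
    (affAction ⁅Z, Z'⁆ : Module.End ℂ (W N m V))
      = affAction Z * affAction Z' - affAction Z' * affAction Z := by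
  have hZ : ∀ Y : Affine m, (affAction Y : Module.End ℂ (W N m V))
      = ∑ q, loopAction q ((LieAlgebra.ofProd (cocycle m)).symm Y).1
        + op LinearMap.id LinearMap.id (LieModule.toEnd ℂ (Affine m) V Y) := fun _ => rfl
  have hfst : ((LieAlgebra.ofProd (cocycle m)).symm ⁅Z, Z'⁆).1
      = ⁅((LieAlgebra.ofProd (cocycle m)).symm Z).1, ((LieAlgebra.ofProd (cocycle m)).symm Z').1⁆ :=
    rfl
  rw [hZ, hZ, hZ, hfst, LieHom.map_lie, Ring.lie_def]
  generalize ((LieAlgebra.ofProd (cocycle m)).symm Z).1 = a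
  generalize ((LieAlgebra.ofProd (cocycle m)).symm Z').1 = b
  generalize LieModule.toEnd ℂ (Affine m) V Z = φ
  generalize LieModule.toEnd ℂ (Affine m) V Z' = ψ
  have h1 : ∀ (c : LieAlgebra.loopAlgebra ℂ ℤ (Mat m)) (χ : Module.End ℂ V),
      (∑ q, loopAction q c : Module.End ℂ (W N m V)) * op LinearMap.id LinearMap.id χ
        = op LinearMap.id LinearMap.id χ * ∑ q, loopAction q c := fun c χ =>
    (Commute.sum_left _ _ _ fun q _ => loopAction_commute_right q c χ).eq
  have h2 : (∑ q, loopAction q ⁅a, b⁆ : Module.End ℂ (W N m V))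
      = (∑ q, loopAction q a) * (∑ q, loopAction q b)
        - (∑ q, loopAction q b) * (∑ q, loopAction q a) := by
    rw [Finset.sum_mul_sum, Finset.sum_mul_sum, Finset.sum_comm (γ := Fin N),
      ← Finset.sum_sub_distrib]
    refine Finset.sum_congr rfl fun q _ => ?_
    rw [← Finset.sum_sub_distrib, Finset.sum_eq_single q, loopAction_lie]
    · intro r _ hr
      rw [(loopAction_commute hr a b).eq, sub_self]
    · simp
  have h3 : (op LinearMap.id LinearMap.id (φ * ψ - ψ * φ) : Module.End ℂ (W N m V))
      = op LinearMap.id LinearMap.id φ * op LinearMap.id LinearMap.id ψ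
        - op LinearMap.id LinearMap.id ψ * op LinearMap.id LinearMap.id φ := by
    rw [op_mul, op_mul, eq_sub_iff_add_eq]
    change _ + op LinearMap.id LinearMap.id (ψ * φ) = op LinearMap.id LinearMap.id (φ * ψ)
    rw [← op_add_right, sub_add_cancel]
  rw [h2, h3]
  simp only [add_mul, mul_add, h1]
  abel

variable (m V) in
/-- Every vector of `V` is annihilated by `t^i gl_m[t]` for some `i`. -/
def IsSmooth : Prop :=
  ∀ v : V, ∃ i : ℤ, ∀ j : ℤ, i ≤ j → ∀ X : Mat m, ⁅cur X j, v⁆ = 0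

variable (m V) in
/-- `V` has level `l`: the central element acts as the scalar `l`. -/
def HasLevel (l : ℂ) : Prop := ∀ v : V, ⁅cen m, v⁆ = l • v

/-- The `i`-th term `∑_{a,b} x_p^{-i} ⊗ E_{ab}^{(p)} ⊗ E_{ba} t^i`. -/
def gapTerm (p : Fin N) (i : ℕ) : Module.End ℂ (W N m V) :=
  ∑ a : Fin m, ∑ b : Fin m, op (mulX p (-(i : ℤ))) (factorOp p (E a b))
    (LieModule.toEnd ℂ (Affine m) V (cur (E b a) i))

theorem gapTerm_eventually_zero (hV : IsSmooth m V) (p : Fin N) (w : W N m V) :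
    ∃ n : ℕ, ∀ i : ℕ, n ≤ i → gapTerm p i w = 0 := by
  induction w using W.induction with
  | zero => exact ⟨0, fun i _ => map_zero _⟩
  | add w w' hw hw' =>
    obtain ⟨n, hn⟩ := hw
    obtain ⟨n', hn'⟩ := hw'
    exact ⟨max n n', fun i hi => by
      rw [map_add, hn i (le_of_max_le_left hi), hn' i (le_of_max_le_right hi), add_zero]⟩
  | tmul f g v =>
    obtain ⟨n, hn⟩ := hV v
    refine ⟨n.toNat, fun i hi => ?_⟩
    have hi' : n ≤ (i : ℤ) := Int.toNat_le.mp hi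
    simp [gapTerm, op_tmul, hn _ hi', W.tmul_zero]

theorem gapTerm_finite (hV : IsSmooth m V) (p : Fin N) (w : W N m V) :
    (Function.support fun i : ℕ => gapTerm p i w).Finite := by
  obtain ⟨n, hn⟩ := gapTerm_eventually_zero hV p w
  refine (Set.finite_lt_nat n).subset fun i hi => ?_
  by_contra h
  exact hi (hn i (not_lt.mp h))

/-- The operator `∑_{i ≥ 0} ∑_{a,b} x_p^{-i} ⊗ E_{ab}^{(p)} ⊗ E_{ba} t^i`; applied to any vector, the
sum over `i` is finite. -/
def gap (hV : IsSmooth m V) (p : Fin N) : Module.End ℂ (W N m V) where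
  toFun w := ∑ᶠ i : ℕ, gapTerm p i w
  map_add' w w' := by
    simp only [map_add]
    exact finsum_add_distrib (gapTerm_finite hV p w) (gapTerm_finite hV p w')
  map_smul' c w := by
    simp only [map_smul, RingHom.id_apply]
    exact (smul_finsum' c (gapTerm_finite hV p w)).symm

/-- The Cherednik operator
`κ x_p ∂_p + ∑_{r ≠ p} x_p (x_p - x_r)⁻¹ (1 - σ_{pr}) ⊗ σ_{pr} ⊗ id + gap`. -/
def cherednikOp (κ : ℂ) (hV : IsSmooth m V) (p : Fin N) : Module.End ℂ (W N m V) :=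
  κ • op (mulX p 1 * partialX p) LinearMap.id LinearMap.id
    + ∑ r : {r : Fin N // r ≠ p},
        op (mulX p 1 * divDiff r.2) (tensPerm m (Equiv.swap p r)) LinearMap.id
    + gap hV p

variable (m) in
/-- The subspace `q = t⁻¹ sl_m[t⁻¹]` of the affine Lie algebra, spanned by the elements `X t^j` with
`j < 0` and `tr X = 0`. -/
def q : Submodule ℂ (Affine m) :=
  Submodule.span ℂ {Z | ∃ (X : Mat m) (j : ℤ), Matrix.trace X = 0 ∧ j < 0 ∧ Z = cur X j}

variable (N m V) in
/-- The subspace `q W` of `W`, spanned by the vectors `Z w` with `Z ∈ q` and `w ∈ W`. -/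
def qW : Submodule ℂ (W N m V) :=
  Submodule.span ℂ {y | ∃ Z ∈ q m, ∃ w : W N m V, y = affAction Z w}

end Action

end TrigCherednik

end

open scoped TensorProduct
noncomputable section
namespace TrigCherednik
attribute [local instance 100] LieRing.ofAssociativeRing

/-! ### Laurent polynomials -/

section Laurent

variable {N : ℕ}

/-! Write `s` for the simultaneous permutations, `P` for those of the tensor factors alone, `z_p`
for the Cherednik operators, and `ω_p(k)` for `∑ E_ab^(p) ⊗ E_ba t^k`, so that the last summand of
`z_p` is `∑_{i ≥ 0} x_p^{-i} ω_p(i)`.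

Equivariance under permutations and the cross relations between `z_p` and `x_q` are direct: the
Euler operator produces `κ x_p`, each divided difference produces one term `x_p s_{pr}` up to sign,
and the sum over `V` commutes with every `x_q`.

The only hard relation of `T_N` is that the `u_p` commute. As `u_p` is `z_p` plus a Jucys–Murphy
element, this reduces to `D = [z_p, z_q] + (z_p - z_q) s_{pq} = 0`. The cross relations alone imply
that `D` commutes with every `x_r` (`cross_commute`), and `W` is generated over Laurent polynomials
by the vectors `1 ⊗ g ⊗ v`, so it is enough that `D` kills these (`eq_zero_of_commute_opX`). On such
vectors the Euler and divided-difference parts of a first `z` vanish, and in a second one they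
survive only through a geometric sum. Invariance of the Casimir tensor gives `[ω_p(j), ω_q(i)] =
P_{pq} (ω_p(i+j) - ω_q(i+j))` for `i, j ≥ 0` (`omega_mul_omega_sub`); the central term is absent as
no exponent is negative. Collecting along `i + j = k`, the commutator contributes every monomial
`x_q^{-i} x_p^{-j}`, the geometric sums remove all but an endpoint, and `(z_p - z_q) s_{pq}` removes
that endpoint.

For the affine Lie algebra, each of the three parts of `z_p` is commuted with `A t^{-j}`, `j ≥ 0`.
All commutators vanish at `j = 0`, which is statement (ii). In general the Euler part gives `-κ j
x_p^{-j} A^(p)`; the divided differences give commutators `[P_{pr}, A^(r)]`; the sum over `V`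
telescopes, leaving `ω_p` at negative exponents and a central term `j C x_p^{-j} A^(p)`. For `tr A =
0` and `C = κ - m`, the total equals `∑_{i<j} ∑_{a,b} ([E_ba, A] t^{i-j}) (x_p^{-i} E_ab^(p))`
(`cherednikOp_affAction`). The level enters through `-κ j + (κ - m) j = -m j`, where `m` comes from
`∑ E_ba E_ab = m`. Every `[E_ba, A] t^{i-j}` lies in `q`, so `z_p` preserves `q W`. The other
generators commute with the affine action. -/

theorem mulX_apply (p : Fin N) (j : ℤ) (f : Laurent N) : mulX p j f = xpow p j * f := rfl

theorem mulX_add (p : Fin N) (i j : ℤ) : mulX p (i + j) = mulX p i * mulX p j := by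
  rw [mulX, mulX, mulX, mulLeft_mul_mulLeft, xpow_add]

theorem mulX_zero (p : Fin N) : mulX p 0 = 1 := by
  refine LinearMap.ext fun f => ?_
  rw [mulX_apply, xpow_zero, one_mul, Module.End.one_apply]

theorem mulX_commute (p q : Fin N) (i j : ℤ) : Commute (mulX p i) (mulX q j) := by
  rw [Commute, SemiconjBy, mulX, mulX, mulLeft_mul_mulLeft, mulLeft_mul_mulLeft, mul_comm]

theorem varPerm_mul_apply (σ τ : Equiv.Perm (Fin N)) (f : Laurent N) :
    varPerm (σ * τ) f = varPerm σ (varPerm τ f) := by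
  induction f using AddMonoidAlgebra.induction_linear with
  | zero => simp
  | add f g hf hg => rw [map_add, map_add, map_add, hf, hg]
  | single k c => rw [varPerm_single, varPerm_single, varPerm_single]; rfl

theorem varPerm_one_apply (f : Laurent N) : varPerm 1 f = f := by
  induction f using AddMonoidAlgebra.induction_linear with
  | zero => simp
  | add f g hf hg => rw [map_add, hf, hg]
  | single k c => rw [varPerm_single]; rfl

theorem varPerm_mul_mulX (σ : Equiv.Perm (Fin N)) (p : Fin N) (j : ℤ) :
    (varPerm σ).toLinearMap * mulX p j = mulX (σ p) j * (varPerm σ).toLinearMap := by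
  refine LinearMap.ext fun f => ?_
  simp only [Module.End.mul_apply, AlgHom.toLinearMap_apply, mulX_apply, map_mul, varPerm_xpow]

/-- The Euler operator `x_p ∂_p`. -/
def euler (p : Fin N) : Module.End ℂ (Laurent N) := mulX p 1 * partialX p

theorem euler_single (p : Fin N) (k : Fin N → ℤ) (c : ℂ) :
    euler p (AddMonoidAlgebra.single k c) = AddMonoidAlgebra.single k ((k p : ℂ) * c) := by
  rw [euler, Module.End.mul_apply, partialX_single, mulX_apply, xpow,
    AddMonoidAlgebra.single_mul_single, add_sub_cancel, one_mul]

theorem euler_xpow_mul (p q : Fin N) (j : ℤ) (f : Laurent N) :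
    euler p (xpow q j * f)
      = xpow q j * euler p f + (if q = p then (j : ℂ) else 0) • (xpow q j * f) := by
  induction f using AddMonoidAlgebra.induction_linear with
  | zero => simp
  | add f g hf hg =>
    rw [mul_add, map_add, hf, hg, map_add, mul_add, smul_add]
    abel
  | single k c =>
    rw [euler_single, xpow, AddMonoidAlgebra.single_mul_single, AddMonoidAlgebra.single_mul_single,
      euler_single, AddMonoidAlgebra.smul_single, ← AddMonoidAlgebra.single_add]
    congr 1
    rcases eq_or_ne q p with rfl | h
    · simp; ring
    · simp [h, h.symm]

theorem euler_mul_mulX (p q : Fin N) (j : ℤ) :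
    euler p * mulX q j = mulX q j * euler p + (if q = p then (j : ℂ) else 0) • mulX q j :=
  LinearMap.ext fun f => euler_xpow_mul p q j f

theorem euler_one (p : Fin N) : euler p 1 = 0 := by
  rw [AddMonoidAlgebra.one_def, euler_single]
  simp

theorem varPerm_mul_euler (σ : Equiv.Perm (Fin N)) (p : Fin N) :
    (varPerm σ).toLinearMap * euler p = euler (σ p) * (varPerm σ).toLinearMap := by
  refine LinearMap.ext fun f => ?_
  simp only [Module.End.mul_apply, AlgHom.toLinearMap_apply]
  induction f using AddMonoidAlgebra.induction_linear with
  | zero => simp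
  | add f g hf hg => simp only [map_add, hf, hg]
  | single k c => simp only [varPerm_single, euler_single]; simp

/-- Division by `x_p - x_r` is unique, so every identity for divided differences can be checked
after multiplying by it. -/
theorem divDiff_eq_of_mul {p r : Fin N} (h : r ≠ p) {f g : Laurent N}
    (hg : (xpow p 1 - xpow r 1) * g = f - varPerm (Equiv.swap p r) f) : divDiff h f = g :=
  mul_left_cancel₀ (xpow_sub_ne_zero h) ((divDiff_spec h f).trans hg.symm)

/-- Twisted Leibniz rule, from `fg - σ(f)σ(g) = σ(f)(g - σ(g)) + (f - σ(f))g`. -/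
theorem divDiff_mul {p r : Fin N} (h : r ≠ p) (f g : Laurent N) :
    divDiff h (f * g) = varPerm (Equiv.swap p r) f * divDiff h g + divDiff h f * g := by
  apply divDiff_eq_of_mul
  rw [mul_add, mul_left_comm, divDiff_spec, ← mul_assoc, divDiff_spec, map_mul]
  ring

theorem divDiff_eq_zero {p r : Fin N} (h : r ≠ p) {f : Laurent N}
    (hf : varPerm (Equiv.swap p r) f = f) : divDiff h f = 0 :=
  divDiff_eq_of_mul h (by rw [mul_zero, hf, sub_self])

theorem divDiff_xpow_of_ne {p q r : Fin N} (h : r ≠ p) (hp : q ≠ p) (hr : q ≠ r) (j : ℤ) :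
    divDiff h (xpow q j) = 0 :=
  divDiff_eq_zero h (by rw [varPerm_xpow, Equiv.swap_apply_of_ne_of_ne hp hr])

theorem divDiff_one {p r : Fin N} (h : r ≠ p) : divDiff h 1 = 0 :=
  divDiff_eq_zero h (map_one _)

theorem divDiff_xpow_right {p r : Fin N} (h : r ≠ p) (j : ℤ) :
    divDiff h (xpow r j) = -divDiff h (xpow p j) := by
  apply divDiff_eq_of_mul
  rw [mul_neg, divDiff_spec, varPerm_xpow, varPerm_xpow, Equiv.swap_apply_left,
    Equiv.swap_apply_right]
  ring

/-- A finite geometric sum: multiplied by `x_p - x_r` the right side telescopes to `x_p (x_r^{-i} -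
x_p^{-i})`. It is the source of every sum over `b < i` below. -/
theorem xpow_mul_divDiff_neg {p r : Fin N} (h : r ≠ p) (i : ℕ) :
    xpow p 1 * divDiff h (xpow r (-(i : ℤ)))
      = ∑ b ∈ Finset.range i, xpow p (-(b : ℤ)) * xpow r ((b : ℤ) - i) := by
  apply mul_left_cancel₀ (xpow_sub_ne_zero h)
  rw [mul_left_comm, divDiff_spec, varPerm_xpow, Equiv.swap_apply_right]
  have key : ∀ b : ℕ, (xpow p 1 - xpow r 1) * (xpow p (-(b : ℤ)) * xpow r ((b : ℤ) - i))
      = xpow p (1 - b) * xpow r ((b : ℤ) - i)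
        - xpow p (1 - ((b + 1 : ℕ) : ℤ)) * xpow r (((b + 1 : ℕ) : ℤ) - i) := by
    intro b
    have e1 : (1 - (b : ℤ)) = 1 + -b := by ring
    have e2 : (1 - ((b + 1 : ℕ) : ℤ)) = -b := by push_cast; ring
    have e3 : (((b + 1 : ℕ) : ℤ) - i) = 1 + (b - i) := by push_cast; ring
    rw [e1, e2, e3, xpow_add, xpow_add]
    ring
  rw [Finset.mul_sum, Finset.sum_congr rfl fun b _ => key b, Finset.sum_range_sub']
  have e4 : (1 - (i : ℤ)) = 1 + -i := by ring
  rw [e4, xpow_add]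
  simp [xpow_zero]
  ring

theorem divDiff_mul_mulX {p r : Fin N} (h : r ≠ p) (q : Fin N) (j : ℤ) :
    divDiff h * mulX q j
      = mulX (Equiv.swap p r q) j * divDiff h + LinearMap.mulLeft ℂ (divDiff h (xpow q j)) := by
  refine LinearMap.ext fun f => ?_
  rw [Module.End.mul_apply, mulX_apply, divDiff_mul, varPerm_xpow]
  rfl

theorem divDiff_mul_mulX_one {p r : Fin N} (h : r ≠ p) :
    divDiff h * mulX p 1 = mulX p 1 * divDiff h + (varPerm (Equiv.swap p r)).toLinearMap := by
  refine LinearMap.ext fun f => ?_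
  refine divDiff_eq_of_mul h ?_
  simp only [LinearMap.add_apply, Module.End.mul_apply, mulX_apply, AlgHom.toLinearMap_apply,
    mul_add, map_mul, varPerm_xpow, Equiv.swap_apply_left]
  rw [mul_left_comm, divDiff_spec]
  ring

theorem divDiff_mul_mulX_one_right {p r : Fin N} (h : r ≠ p) :
    divDiff h * mulX r 1 = mulX r 1 * divDiff h - (varPerm (Equiv.swap p r)).toLinearMap := by
  refine LinearMap.ext fun f => ?_
  refine divDiff_eq_of_mul h ?_
  simp only [LinearMap.sub_apply, Module.End.mul_apply, mulX_apply, AlgHom.toLinearMap_apply,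
    mul_sub, map_mul, varPerm_xpow, Equiv.swap_apply_right]
  rw [mul_left_comm, divDiff_spec]
  ring

theorem divDiff_mul_mulX_of_ne {p q r : Fin N} (h : r ≠ p) (hp : q ≠ p) (hr : q ≠ r) (j : ℤ) :
    divDiff h * mulX q j = mulX q j * divDiff h := by
  rw [divDiff_mul_mulX, Equiv.swap_apply_of_ne_of_ne hp hr, divDiff_xpow_of_ne h hp hr,
    LinearMap.mulLeft_zero_eq_zero, add_zero]

theorem varPerm_mul_divDiff (σ : Equiv.Perm (Fin N)) {p r : Fin N} (h : r ≠ p)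
    (h' : σ r ≠ σ p) :
    (varPerm σ).toLinearMap * divDiff h = divDiff h' * (varPerm σ).toLinearMap := by
  refine LinearMap.ext fun f => ?_
  simp only [Module.End.mul_apply, AlgHom.toLinearMap_apply]
  refine (divDiff_eq_of_mul h' ?_).symm
  have hσ : Equiv.swap (σ p) (σ r) * σ = σ * Equiv.swap p r := by
    rw [Equiv.swap_apply_apply, inv_mul_cancel_right]
  rw [← varPerm_mul_apply, hσ, varPerm_mul_apply, ← map_sub, ← divDiff_spec h, map_mul, map_sub,
    varPerm_xpow, varPerm_xpow]

/-- Induction on Laurent polynomials, starting from `1` and multiplying by powers of variables. -/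
theorem induction_xpow {P : Laurent N → Prop} (zero : P 0) (add : ∀ f g, P f → P g → P (f + g))
    (smul : ∀ (c : ℂ) f, P f → P (c • f)) (one : P 1) (mul : ∀ p j f, P f → P (xpow p j * f))
    (f : Laurent N) : P f := by
  have hmono : ∀ (k : Fin N → ℤ) (t : Finset (Fin N)),
      P (AddMonoidAlgebra.single (∑ q ∈ t, Pi.single q (k q)) 1) := by
    intro k t
    induction t using Finset.induction_on with
    | empty => simpa [AddMonoidAlgebra.one_def] using one
    | insert a t ha ih =>
      have := mul a (k a) _ ih
      rw [Finset.sum_insert ha]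
      rwa [xpow, AddMonoidAlgebra.single_mul_single, one_mul] at this
  induction f using AddMonoidAlgebra.induction_linear with
  | zero => exact zero
  | add f g hf hg => exact add f g hf hg
  | single k c =>
    have := smul c _ (hmono k Finset.univ)
    rwa [Finset.univ_sum_single, AddMonoidAlgebra.smul_single, smul_eq_mul, mul_one] at this

end Laurent

/-! ### Tensor powers -/

section Tensors

variable {N m : ℕ}

theorem tens_hom_ext {φ ψ : Module.End ℂ (Tens N m)}
    (h : ∀ v, φ (PiTensorProduct.tprod ℂ v) = ψ (PiTensorProduct.tprod ℂ v)) : φ = ψ :=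
  PiTensorProduct.ext (MultilinearMap.ext h)

theorem tensPerm_mul (σ τ : Equiv.Perm (Fin N)) :
    tensPerm m (σ * τ) = tensPerm m σ * tensPerm m τ :=
  tens_hom_ext fun v => by
    rw [Module.End.mul_apply, tensPerm_tprod, tensPerm_tprod, tensPerm_tprod]
    rfl

theorem tensPerm_one : tensPerm (N := N) m 1 = 1 :=
  tens_hom_ext fun v => by rw [tensPerm_tprod]; rfl

theorem tensPerm_mul_factorOp (σ : Equiv.Perm (Fin N)) (p : Fin N) (A : Mat m) :
    tensPerm m σ * factorOp p A = factorOp (σ p) A * tensPerm m σ :=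
  tens_hom_ext fun v => by
    simp only [Module.End.mul_apply, tensPerm_tprod, factorOp_tprod, Equiv.symm_apply_apply]
    congr 1
    ext1 i
    rcases eq_or_ne i (σ p) with rfl | h
    · simp
    · rw [Function.update_of_ne h, Function.update_of_ne]
      rwa [ne_eq, Equiv.symm_apply_eq]

/-- The flip of two tensor factors is the Casimir tensor of `gl_m` acting on them. This lets the
reflection terms interact with the sum over `V`. -/
theorem tensPerm_swap {p q : Fin N} (h : q ≠ p) :
    tensPerm m (Equiv.swap p q)
      = ∑ a : Fin m, ∑ b : Fin m, factorOp p (E a b) * factorOp q (E b a) :=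
  tens_hom_ext fun v => by
    have hE : ∀ (a b : Fin m) (w : Fin m → ℂ), (E a b).mulVec w = w b • Pi.single a 1 := by
      intro a b w
      rw [Matrix.single_mulVec, ← Pi.single_smul, one_mul, smul_eq_mul, mul_one]
      rfl
    have hsum : ∀ w : Fin m → ℂ, w = ∑ a, w a • Pi.single a (1 : ℂ) := fun w =>
      pi_eq_sum_univ' w
    simp only [LinearMap.sum_apply, Module.End.mul_apply, factorOp_tprod, tensPerm_tprod,
      Function.update_of_ne h.symm, hE, MultilinearMap.map_update_smul, map_smul]
    -- The swapped family is written as `v` with two entries replaced by basis expansions, so that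
    -- multilinearity yields the double sum.
    have hv : (fun i => v ((Equiv.swap p q).symm i))
        = Function.update (Function.update v p (∑ a, v q a • Pi.single a (1 : ℂ))) q
          (∑ b, v p b • Pi.single b (1 : ℂ)) := by
      rw [← hsum, ← hsum]
      ext1 i
      rw [Equiv.symm_swap]
      rcases eq_or_ne i q with rfl | hq
      · rw [Equiv.swap_apply_right, Function.update_self]
      rcases eq_or_ne i p with rfl | hp
      · rw [Equiv.swap_apply_left, Function.update_of_ne hq, Function.update_self]
      · rw [Equiv.swap_apply_of_ne_of_ne hp hq, Function.update_of_ne hq, Function.update_of_ne hp]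
    rw [hv, MultilinearMap.map_update_sum, Finset.sum_comm]
    refine Finset.sum_congr rfl fun b _ => ?_
    rw [Function.update_comm h.symm, MultilinearMap.map_update_sum]
    refine Finset.sum_congr rfl fun a _ => ?_
    rw [Function.update_comm h, MultilinearMap.map_update_smul, Function.update_comm h.symm,
      MultilinearMap.map_update_smul, Function.update_comm h, smul_comm]

end Tensors

/-! ### The Casimir tensor of `gl_m` -/

section Casimir

variable {m : ℕ} {M : Type*} [AddCommGroup M] [Module ℂ M]

theorem mul_E (A : Mat m) (a b : Fin m) : A * E a b = ∑ c, A c a • E c b := by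
  ext i j
  rw [Matrix.sum_apply]
  rcases eq_or_ne b j with rfl | h
  · simp [Matrix.single_apply]
  · simp [h, h.symm]

theorem E_mul (A : Mat m) (a b : Fin m) : E a b * A = ∑ c, A b c • E a c := by
  ext i j
  rw [Matrix.sum_apply]
  rcases eq_or_ne a i with rfl | h
  · simp [Matrix.single_apply]
  · simp [h, h.symm]

theorem casimir_mul_right (B : Mat m →ₗ[ℂ] Mat m →ₗ[ℂ] M) (A : Mat m) :
    ∑ a, ∑ b, B (E a b * A) (E b a) = ∑ a, ∑ b, B (E a b) (A * E b a) := by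
  refine Finset.sum_congr rfl fun a _ => ?_
  simp only [mul_E, E_mul, map_sum, map_smul, LinearMap.sum_apply, LinearMap.smul_apply]
  rw [Finset.sum_comm]

theorem casimir_mul_left (B : Mat m →ₗ[ℂ] Mat m →ₗ[ℂ] M) (A : Mat m) :
    ∑ a, ∑ b, B (A * E a b) (E b a) = ∑ a, ∑ b, B (E a b) (E b a * A) := by
  rw [Finset.sum_comm]
  conv_rhs => rw [Finset.sum_comm]
  refine Finset.sum_congr rfl fun b _ => ?_
  simp only [mul_E, E_mul, map_sum, map_smul, LinearMap.sum_apply, LinearMap.smul_apply]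
  rw [Finset.sum_comm]

/-- Adjoint invariance of `∑ E_ab ⊗ E_ba`. An arbitrary bilinear `B` allows the two legs to act on
different factors of `W`. -/
theorem casimir_lie (B : Mat m →ₗ[ℂ] Mat m →ₗ[ℂ] M) (A : Mat m) :
    ∑ a, ∑ b, B (E a b) (A * E b a - E b a * A) = ∑ a, ∑ b, B (E a b * A - A * E a b) (E b a) := by
  simp only [map_sub, LinearMap.sub_apply, Finset.sum_sub_distrib, casimir_mul_left,
    casimir_mul_right]

theorem sum_trace_smul_E (A : Mat m) :
    ∑ a, ∑ b, Matrix.trace (A * E b a) • E a b = A := by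
  conv_rhs => rw [Matrix.matrix_eq_sum_single A]
  refine Finset.sum_congr rfl fun a _ => Finset.sum_congr rfl fun b _ => ?_
  rw [Matrix.trace_mul_single, Matrix.smul_single]
  simp

theorem sum_E : ∑ a : Fin m, E a a = 1 := by
  ext i j
  rw [Matrix.sum_apply]
  rcases eq_or_ne i j with rfl | h
  · simp [Matrix.single_apply]
  · rw [Matrix.one_apply_ne h]
    refine Finset.sum_eq_zero fun a _ => ?_
    exact (Matrix.single_apply _ _ _ _ _).trans (if_neg fun h' => h (h'.1.symm.trans h'.2))

/-- Explains both conditions in (iii): it vanishes for traceless `A`, and at `A = 1` it gives the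
shift `m` of the level. -/
theorem sum_E_mul_mul_E (A : Mat m) :
    ∑ a, ∑ b, E b a * A * E a b = Matrix.trace A • (1 : Mat m) := by
  have h : ∀ a b : Fin m, E b a * A * E a b = A a a • E b b := by
    intro a b
    rw [E_mul, Finset.sum_mul]
    simp only [smul_mul_assoc]
    rw [Finset.sum_eq_single a]
    · simp
    · intro c _ hc
      simp [Matrix.single_mul_single_of_ne, hc]
    · simp
  simp only [h, ← Finset.smul_sum, sum_E, ← Finset.sum_smul]
  rfl

theorem sum_E_mul_E : ∑ a : Fin m, ∑ b, E b a * E a b = (m : ℂ) • (1 : Mat m) := by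
  have := sum_E_mul_mul_E (1 : Mat m)
  simpa using this

end Casimir

/-! ### Operators on `W` -/

section Operators

variable {N m : ℕ} {V : Type*} [AddCommGroup V] [Module ℂ V]

theorem op_commute {f f' : Module.End ℂ (Laurent N)} {g g' : Module.End ℂ (Tens N m)}
    {h h' : Module.End ℂ V} (hf : Commute f f') (hg : Commute g g') (hh : Commute h h') :
    Commute (op f g h : Module.End ℂ (W N m V)) (op f' g' h') := by
  rw [Commute, SemiconjBy, op_mul, op_mul, hf.eq, hg.eq, hh.eq]

theorem op_one : (op 1 1 1 : Module.End ℂ (W N m V)) = 1 :=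
  W.hom_ext fun f g v => by rw [op_tmul]; rfl

theorem op_sub_left (f f' : Module.End ℂ (Laurent N)) (g : Module.End ℂ (Tens N m))
    (h : Module.End ℂ V) :
    (op (f - f') g h : Module.End ℂ (W N m V)) = op f g h - op f' g h := by
  rw [eq_sub_iff_add_eq, ← op_add_left, sub_add_cancel]

/-- Multiplication by `x_p^j` on `W`. -/
def opX (p : Fin N) (j : ℤ) : Module.End ℂ (W N m V) := op (mulX p j) LinearMap.id LinearMap.id

/-- The operator `id ⊗ g ⊗ id` on `W`. -/
def opTens : Module.End ℂ (Tens N m) →ₗ[ℂ] Module.End ℂ (W N m V) where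
  toFun g := op LinearMap.id g LinearMap.id
  map_add' g g' := op_add_mid _ g g' _
  map_smul' c g := op_smul_mid c _ g _

theorem opTens_apply (g : Module.End ℂ (Tens N m)) :
    (opTens g : Module.End ℂ (W N m V)) = op LinearMap.id g LinearMap.id := rfl

/-- The operator `A^{(p)}` on `W`. -/
def opF (p : Fin N) : Mat m →ₗ[ℂ] Module.End ℂ (W N m V) where
  toFun A := op LinearMap.id (factorOp p A) LinearMap.id
  map_add' A B := by rw [factorOp_add, op_add_mid]
  map_smul' c A := by rw [factorOp_smul, op_smul_mid]; rfl

/-- The simultaneous permutation of variables and tensor factors. -/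
def opS (σ : Equiv.Perm (Fin N)) : Module.End ℂ (W N m V) :=
  op (varPerm σ).toLinearMap (tensPerm m σ) LinearMap.id

/-- The permutation of tensor factors on `W`. -/
def opP (σ : Equiv.Perm (Fin N)) : Module.End ℂ (W N m V) :=
  op LinearMap.id (tensPerm m σ) LinearMap.id

theorem opF_apply (p : Fin N) (A : Mat m) :
    (opF p A : Module.End ℂ (W N m V)) = op LinearMap.id (factorOp p A) LinearMap.id := rfl

theorem opX_add (p : Fin N) (i j : ℤ) :
    (opX p (i + j) : Module.End ℂ (W N m V)) = opX p i * opX p j := by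
  rw [opX, opX, opX, op_mul, mulX_add]
  rfl

theorem opX_zero (p : Fin N) : (opX p 0 : Module.End ℂ (W N m V)) = 1 := by
  rw [opX, mulX_zero]
  exact op_one

theorem opX_commute (p q : Fin N) (i j : ℤ) :
    Commute (opX p i : Module.End ℂ (W N m V)) (opX q j) :=
  op_commute (mulX_commute p q i j) rfl rfl

theorem opX_commute_opF (p q : Fin N) (i : ℤ) (A : Mat m) :
    Commute (opX p i : Module.End ℂ (W N m V)) (opF q A) :=
  op_commute (Commute.one_right _) (Commute.one_left _) rfl

theorem opF_commute {p q : Fin N} (h : p ≠ q) (A B : Mat m) :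
    Commute (opF p A : Module.End ℂ (W N m V)) (opF q B) :=
  op_commute rfl (factorOp_commute h A B) rfl

theorem opF_mul (p : Fin N) (A B : Mat m) :
    (opF p (A * B) : Module.End ℂ (W N m V)) = opF p A * opF p B := by
  rw [opF_apply, opF_apply, opF_apply, op_mul, factorOp_mul]
  rfl

theorem opS_mul (σ τ : Equiv.Perm (Fin N)) :
    (opS (σ * τ) : Module.End ℂ (W N m V)) = opS σ * opS τ := by
  rw [opS, opS, opS, op_mul, tensPerm_mul]
  congr 1
  exact LinearMap.ext fun f => varPerm_mul_apply σ τ f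

theorem opS_one : (opS 1 : Module.End ℂ (W N m V)) = 1 := by
  rw [opS, tensPerm_one]
  have h : (varPerm (1 : Equiv.Perm (Fin N))).toLinearMap = 1 :=
    LinearMap.ext varPerm_one_apply
  rw [h]
  exact op_one

theorem opS_mul_opX (σ : Equiv.Perm (Fin N)) (p : Fin N) (j : ℤ) :
    (opS σ * opX p j : Module.End ℂ (W N m V)) = opX (σ p) j * opS σ := by
  rw [opS, opX, opX, op_mul, op_mul, varPerm_mul_mulX]
  rfl

theorem opS_mul_opF (σ : Equiv.Perm (Fin N)) (p : Fin N) (A : Mat m) :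
    (opS σ * opF p A : Module.End ℂ (W N m V)) = opF (σ p) A * opS σ := by
  rw [opS, opF_apply, opF_apply, op_mul, op_mul, tensPerm_mul_factorOp]
  rfl

theorem opP_mul_opF (σ : Equiv.Perm (Fin N)) (p : Fin N) (A : Mat m) :
    (opP σ * opF p A : Module.End ℂ (W N m V)) = opF (σ p) A * opP σ := by
  rw [opP, opF_apply, opF_apply, op_mul, op_mul, tensPerm_mul_factorOp]

theorem opP_swap {p q : Fin N} (h : q ≠ p) :
    (opP (Equiv.swap p q) : Module.End ℂ (W N m V))
      = ∑ a : Fin m, ∑ b : Fin m, opF p (E a b) * opF q (E b a) := by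
  rw [opP, tensPerm_swap h, ← opTens_apply]
  simp only [map_sum]
  refine Finset.sum_congr rfl fun a _ => Finset.sum_congr rfl fun b _ => ?_
  rw [opTens_apply, opF_apply, opF_apply, op_mul]
  rfl

variable [LieRingModule (Affine m) V] [LieModule ℂ (Affine m) V]

/-- The operator `id ⊗ id ⊗ Z` on `W`, for `Z` in the affine Lie algebra. -/
def opV (N : ℕ) : Affine m →ₗ[ℂ] Module.End ℂ (W N m V) where
  toFun Z := op LinearMap.id LinearMap.id (LieModule.toEnd ℂ (Affine m) V Z)
  map_add' Z Z' := by rw [map_add, op_add_right]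
  map_smul' c Z := by rw [map_smul, op_smul_right]; rfl

theorem opV_apply (Z : Affine m) : (opV N Z : Module.End ℂ (W N m V))
    = op LinearMap.id LinearMap.id (LieModule.toEnd ℂ (Affine m) V Z) := rfl

theorem opV_tmul (Z : Affine m) (f : Laurent N) (g : Tens N m) (v : V) :
    opV N Z (W.tmul f g v) = W.tmul f g ⁅Z, v⁆ := by
  rw [opV_apply, op_tmul]
  rfl

theorem opV_mul_opV (Z Z' : Affine m) :
    (opV N Z * opV N Z' : Module.End ℂ (W N m V)) - opV N Z' * opV N Z = opV N ⁅Z, Z'⁆ := by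
  refine W.hom_ext fun f g v => ?_
  rw [LinearMap.sub_apply, Module.End.mul_apply, Module.End.mul_apply]
  simp only [opV_tmul]
  rw [sub_eq_iff_eq_add, ← W.tmul_add, ← leibniz_lie]

theorem opV_commute_opX (Z : Affine m) (p : Fin N) (i : ℤ) :
    Commute (opV N Z : Module.End ℂ (W N m V)) (opX p i) :=
  op_commute (Commute.one_left _) rfl (Commute.one_right _)

theorem opV_commute_opF (Z : Affine m) (p : Fin N) (A : Mat m) :
    Commute (opV N Z : Module.End ℂ (W N m V)) (opF p A) :=
  op_commute rfl (Commute.one_left _) (Commute.one_right _)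

theorem opV_commute_opP (Z : Affine m) (σ : Equiv.Perm (Fin N)) :
    Commute (opV N Z : Module.End ℂ (W N m V)) (opP σ) :=
  op_commute rfl (Commute.one_left _) (Commute.one_right _)

theorem opV_commute_opS (Z : Affine m) (σ : Equiv.Perm (Fin N)) :
    Commute (opV N Z : Module.End ℂ (W N m V)) (opS σ) :=
  op_commute (Commute.one_left _) (Commute.one_left _) (Commute.one_right _)

/-- `X ↦ X t^j` as a linear map. -/
def curₗ (j : ℤ) : Mat m →ₗ[ℂ] Affine m where
  toFun X := cur X j
  map_add' X Y := by
    rw [cur, cur, cur, ← LieAlgebra.of_add, TensorProduct.tmul_add, Prod.mk_add_mk, add_zero]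
  map_smul' c X := by
    rw [cur, cur, RingHom.id_apply, ← LieAlgebra.of_smul, TensorProduct.tmul_smul, Prod.smul_mk,
      smul_zero]

/-- The operator `id ⊗ id ⊗ X t^j`. -/
def opCur (N : ℕ) (j : ℤ) : Mat m →ₗ[ℂ] Module.End ℂ (W N m V) := opV N ∘ₗ curₗ j

theorem opCur_apply (j : ℤ) (A : Mat m) :
    (opCur N j A : Module.End ℂ (W N m V)) = opV N (cur A j) := rfl

theorem affAction_cur_eq (A : Mat m) (j : ℤ) :
    (affAction (cur A j) : Module.End ℂ (W N m V))
      = ∑ q, opX q j * opF q A + opCur N j A := by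
  rw [affAction_cur]
  congr 1
  refine Finset.sum_congr rfl fun q _ => ?_
  rw [opX, opF_apply, op_mul]
  rfl

theorem opCur_mul_opCur (A B : Mat m) (i j : ℤ) :
    (opCur N i A * opCur N j B : Module.End ℂ (W N m V)) - opCur N j B * opCur N i A
      = opCur N (i + j) (A * B - B * A)
        + (if i = -j then (i : ℂ) * Matrix.trace (A * B) else 0) • opV N (cen m) := by
  rw [opCur_apply, opCur_apply, opV_mul_opV, lie_cur, map_add, map_smul]
  rfl

/-- The operator `∑_{a,b} E_{ab}^{(p)} ⊗ E_{ba} t^k`. -/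
def omega (p : Fin N) (k : ℤ) : Module.End ℂ (W N m V) :=
  ∑ a : Fin m, ∑ b : Fin m, opF p (E a b) * opCur N k (E b a)

theorem gapTerm_eq (p : Fin N) (i : ℕ) :
    (gapTerm p i : Module.End ℂ (W N m V)) = opX p (-(i : ℤ)) * omega p i := by
  rw [gapTerm, omega, Finset.mul_sum]
  refine Finset.sum_congr rfl fun a _ => ?_
  rw [Finset.mul_sum]
  refine Finset.sum_congr rfl fun b _ => ?_
  rw [opX, opF_apply, opCur_apply, opV_apply, op_mul, op_mul]
  rfl

theorem omega_commute {p : Fin N} {k : ℤ} {φ : Module.End ℂ (W N m V)}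
    (h1 : ∀ A : Mat m, Commute (opF p A) φ) (h2 : ∀ A : Mat m, Commute (opCur N k A) φ) :
    Commute (omega p k) φ :=
  Commute.sum_left _ _ _ fun _ _ => Commute.sum_left _ _ _ fun _ _ => (h1 _).mul_left (h2 _)

theorem omega_commute_opX (p q : Fin N) (k j : ℤ) :
    Commute (omega p k : Module.End ℂ (W N m V)) (opX q j) :=
  omega_commute (fun A => (opX_commute_opF q p j A).symm) fun _ => opV_commute_opX _ q j

theorem omega_commute_opF {p q : Fin N} (h : p ≠ q) (k : ℤ) (A : Mat m) :
    Commute (omega p k : Module.End ℂ (W N m V)) (opF q A) :=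
  omega_commute (fun B => opF_commute h B A) fun _ => opV_commute_opF _ q A

theorem opS_mul_omega (σ : Equiv.Perm (Fin N)) (p : Fin N) (k : ℤ) :
    (opS σ * omega p k : Module.End ℂ (W N m V)) = omega (σ p) k * opS σ := by
  simp only [omega, Finset.mul_sum, Finset.sum_mul]
  refine Finset.sum_congr rfl fun a _ => Finset.sum_congr rfl fun b _ => ?_
  rw [← mul_assoc, opS_mul_opF, mul_assoc, mul_assoc, opCur_apply, (opV_commute_opS _ σ).eq]

theorem opP_mul_omega (σ : Equiv.Perm (Fin N)) (p : Fin N) (k : ℤ) :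
    (opP σ * omega p k : Module.End ℂ (W N m V)) = omega (σ p) k * opP σ := by
  simp only [omega, Finset.mul_sum, Finset.sum_mul]
  refine Finset.sum_congr rfl fun a _ => Finset.sum_congr rfl fun b _ => ?_
  rw [← mul_assoc, opP_mul_opF, mul_assoc, mul_assoc, opCur_apply, (opV_commute_opP _ σ).eq]

/-- The commutator of `∑ E_{ab}^{(p)} ⊗ E_{ba} t^k` with `A^{(p)}`, in terms of that with `A`. -/
theorem omega_mul_opF_sub (p : Fin N) (k : ℤ) (A : Mat m) :
    (omega p k * opF p A - opF p A * omega p k : Module.End ℂ (W N m V))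
      = ∑ a, ∑ b, opF p (E a b) * opCur N k (A * E b a - E b a * A) := by
  have := casimir_lie
    ((LinearMap.mul ℂ (Module.End ℂ (W N m V))).compl₁₂ (opF p) (opCur N k)) A
  simp only [LinearMap.compl₁₂_apply, LinearMap.mul_apply'] at this
  rw [this]
  simp only [omega, Finset.mul_sum, Finset.sum_mul, ← Finset.sum_sub_distrib]
  refine Finset.sum_congr rfl fun a _ => Finset.sum_congr rfl fun b _ => ?_
  rw [map_sub, opF_mul, opF_mul, mul_assoc, opCur_apply, (opV_commute_opF _ p A).eq]
  noncomm_ring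

/-- The bracket falls on the leg in `V`, and Casimir invariance moves it to the leg in the `q`-th
factor. The cocycle contributes `∑ tr(A E_ba) E_ab = A`. -/
theorem opCur_mul_omega_sub (q : Fin N) (i k : ℤ) (A : Mat m) :
    (opCur N k A * omega q i - omega q i * opCur N k A : Module.End ℂ (W N m V))
      = omega q (k + i) * opF q A - opF q A * omega q (k + i)
        + (if k = -i then (k : ℂ) else 0) • (opF q A * opV N (cen m)) := by
  have h1 : ∀ a b : Fin m, (opCur N k A * (opF q (E a b) * opCur N i (E b a))
        - opF q (E a b) * opCur N i (E b a) * opCur N k A : Module.End ℂ (W N m V))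
      = opF q (E a b) * opCur N (k + i) (A * E b a - E b a * A)
        + (if k = -i then (k : ℂ) else 0) •
          (opF q (Matrix.trace (A * E b a) • E a b) * opV N (cen m)) := by
    intro a b
    rw [← mul_assoc, opCur_apply k, (opV_commute_opF _ q _).eq, ← opCur_apply, mul_assoc, mul_assoc,
      ← mul_sub, opCur_mul_opCur, mul_add, mul_smul_comm, map_smul, smul_mul_assoc, smul_smul]
    congr 2
    split_ifs <;> simp
  have h2 : (opF q A * opV N (cen m) : Module.End ℂ (W N m V))
      = ∑ a, ∑ b, opF q (Matrix.trace (A * E b a) • E a b) * opV N (cen m) := by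
    conv_lhs => rw [← sum_trace_smul_E A]
    simp only [map_sum, Finset.sum_mul]
  rw [omega_mul_opF_sub, h2]
  simp only [omega, Finset.mul_sum, Finset.sum_mul, ← Finset.sum_sub_distrib, h1,
    Finset.sum_add_distrib, Finset.smul_sum]

/-- Applying `opCur_mul_omega_sub` to each `E_ba t^j` in the `p`-th sum gives `[ω_q(i+j), ∑ E_ab^(p)
E_ba^(q)]`, the commutator with the flip, and the flip carries `ω_p` to `ω_q`. The condition `hij`
makes the cocycle coefficient zero. -/
theorem omega_mul_omega_sub {p q : Fin N} (h : q ≠ p) (i j : ℤ) (hij : j = -i → j = 0) :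
    (omega p j * omega q i - omega q i * omega p j : Module.End ℂ (W N m V))
      = opP (Equiv.swap p q) * (omega p (i + j) - omega q (i + j)) := by
  have h1 : ∀ a b : Fin m, (opF p (E a b) * opCur N j (E b a) * omega q i
        - omega q i * (opF p (E a b) * opCur N j (E b a)) : Module.End ℂ (W N m V))
      = omega q (i + j) * (opF p (E a b) * opF q (E b a))
        - opF p (E a b) * opF q (E b a) * omega q (i + j) := by
    intro a b
    have h2 : (if j = -i then (j : ℂ) else 0) = 0 := by
      split_ifs with h3
      · simp [hij h3]
      · rfl
    have h3 := opCur_mul_omega_sub (V := V) q i j (E b a)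
    rw [h2, zero_smul, add_zero, add_comm j] at h3
    rw [← mul_assoc, (omega_commute_opF h i (E a b)).eq, mul_assoc, mul_assoc, ← mul_sub, h3,
      mul_sub, ← mul_assoc, ← (omega_commute_opF h (i + j) (E a b)).eq, mul_assoc, mul_assoc]
  have h4 : (omega q (i + j) * opP (Equiv.swap p q) : Module.End ℂ (W N m V))
      = opP (Equiv.swap p q) * omega p (i + j) := by
    rw [opP_mul_omega, Equiv.swap_apply_left]
  rw [mul_sub, ← h4, opP_swap h]
  conv_lhs => rw [omega]
  simp only [Finset.mul_sum, Finset.sum_mul, ← Finset.sum_sub_distrib, h1]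

end Operators

/-! ### The Cherednik operators -/

section Cherednik

variable {N m : ℕ} {V : Type*} [AddCommGroup V] [Module ℂ V]

/-- The operator `x_p ∂_p ⊗ id ⊗ id`. -/
def opEuler (p : Fin N) : Module.End ℂ (W N m V) := op (euler p) LinearMap.id LinearMap.id

/-- The operator `x_p (x_p - x_r)⁻¹ (1 - σ_{pr}) ⊗ σ_{pr} ⊗ id`, and zero if `r = p`. -/
def opRefl (p r : Fin N) : Module.End ℂ (W N m V) :=
  if h : r ≠ p then op (mulX p 1 * divDiff h) (tensPerm m (Equiv.swap p r)) LinearMap.id else 0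

theorem opRefl_of_ne {p r : Fin N} (h : r ≠ p) : (opRefl p r : Module.End ℂ (W N m V))
    = op (mulX p 1 * divDiff h) (tensPerm m (Equiv.swap p r)) LinearMap.id := dif_pos h

theorem opRefl_self (p : Fin N) : (opRefl p p : Module.End ℂ (W N m V)) = 0 :=
  dif_neg (not_not.mpr rfl)

theorem opEuler_mul_opX (p q : Fin N) (j : ℤ) :
    (opEuler p * opX q j : Module.End ℂ (W N m V))
      = opX q j * opEuler p + (if q = p then (j : ℂ) else 0) • opX q j := by
  rw [opEuler, opX, op_mul, op_mul, euler_mul_mulX, op_add_left, op_smul_left]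
  rfl

theorem opEuler_commute_opX {p q : Fin N} (h : q ≠ p) (j : ℤ) :
    Commute (opEuler p : Module.End ℂ (W N m V)) (opX q j) := by
  rw [Commute, SemiconjBy, opEuler_mul_opX, if_neg h, zero_smul, add_zero]

theorem opEuler_commute_opF (p q : Fin N) (A : Mat m) :
    Commute (opEuler p : Module.End ℂ (W N m V)) (opF q A) :=
  op_commute (Commute.one_right _) (Commute.one_left _) rfl

theorem opS_mul_opEuler (σ : Equiv.Perm (Fin N)) (p : Fin N) :
    (opS σ * opEuler p : Module.End ℂ (W N m V)) = opEuler (σ p) * opS σ := by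
  rw [opS, opEuler, opEuler, op_mul, op_mul, varPerm_mul_euler]
  rfl

theorem opS_mul_opRefl (σ : Equiv.Perm (Fin N)) (p r : Fin N) :
    (opS σ * opRefl p r : Module.End ℂ (W N m V)) = opRefl (σ p) (σ r) * opS σ := by
  rcases eq_or_ne r p with rfl | h
  · rw [opRefl_self, opRefl_self, mul_zero, zero_mul]
  have h' : σ r ≠ σ p := fun h0 => h (σ.injective h0)
  rw [opRefl_of_ne h, opRefl_of_ne h', opS, op_mul, op_mul, ← tensPerm_mul, ← tensPerm_mul,
    Equiv.swap_apply_apply, inv_mul_cancel_right, ← mul_assoc, varPerm_mul_mulX, mul_assoc,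
    varPerm_mul_divDiff σ h h', mul_assoc]

theorem opRefl_commute_opX {p q r : Fin N} (hp : q ≠ p) (hr : q ≠ r) (j : ℤ) :
    Commute (opRefl p r : Module.End ℂ (W N m V)) (opX q j) := by
  rcases eq_or_ne r p with rfl | h
  · rw [opRefl_self]
    exact Commute.zero_left _
  rw [opRefl_of_ne h]
  refine op_commute ?_ (Commute.one_right _) rfl
  rw [Commute, SemiconjBy, mul_assoc, divDiff_mul_mulX_of_ne h hp hr, ← mul_assoc, ← mul_assoc,
    (mulX_commute p q 1 j).eq]

theorem opRefl_mul_opX_left {p r : Fin N} (h : r ≠ p) :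
    (opRefl p r * opX p 1 : Module.End ℂ (W N m V))
      = opX p 1 * opRefl p r + opX p 1 * opS (Equiv.swap p r) := by
  rw [opRefl_of_ne h, opX, opS, op_mul, op_mul, op_mul, mul_assoc, divDiff_mul_mulX_one, mul_add,
    op_add_left]
  rfl

theorem opRefl_mul_opX_right {p r : Fin N} (h : r ≠ p) :
    (opRefl p r * opX r 1 : Module.End ℂ (W N m V))
      = opX r 1 * opRefl p r - opX p 1 * opS (Equiv.swap p r) := by
  rw [opRefl_of_ne h, opX, opX, opS, op_mul, op_mul, op_mul, mul_assoc,
    divDiff_mul_mulX_one_right, mul_sub, op_sub_left, ← mul_assoc, (mulX_commute p r 1 1).eq]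
  rfl

theorem opRefl_commute_opF {p q r : Fin N} (hp : q ≠ p) (hr : q ≠ r) (A : Mat m) :
    Commute (opRefl p r : Module.End ℂ (W N m V)) (opF q A) := by
  rcases eq_or_ne r p with rfl | h
  · rw [opRefl_self]
    exact Commute.zero_left _
  rw [opRefl_of_ne h]
  refine op_commute (Commute.one_right _) ?_ rfl
  rw [Commute, SemiconjBy, tensPerm_mul_factorOp, Equiv.swap_apply_of_ne_of_ne hp hr]

variable [LieRingModule (Affine m) V] [LieModule ℂ (Affine m) V]

theorem opEuler_commute_opV (p : Fin N) (Z : Affine m) :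
    Commute (opEuler p : Module.End ℂ (W N m V)) (opV N Z) :=
  op_commute (Commute.one_right _) rfl (Commute.one_left _)

theorem opRefl_commute_opV (p r : Fin N) (Z : Affine m) :
    Commute (opRefl p r : Module.End ℂ (W N m V)) (opV N Z) := by
  rcases eq_or_ne r p with rfl | h
  · rw [opRefl_self]
    exact Commute.zero_left _
  rw [opRefl_of_ne h]
  exact op_commute (Commute.one_right _) (Commute.one_right _) (Commute.one_left _)

theorem cherednikOp_eq (κ : ℂ) (hV : IsSmooth m V) (p : Fin N) :
    cherednikOp κ hV p = κ • opEuler p + ∑ r, opRefl p r + gap hV p := by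
  rw [cherednikOp]
  congr 2
  have h1 : ∑ r, (opRefl p r : Module.End ℂ (W N m V))
      = ∑ r ∈ Finset.univ.filter (fun r => r ≠ p), opRefl p r := by
    refine (Finset.sum_filter_of_ne fun r _ hr => ?_).symm
    rintro rfl
    exact hr (opRefl_self _)
  rw [h1, Finset.sum_subtype (p := fun r => r ≠ p) _ (by simp)]
  exact Finset.sum_congr rfl fun r _ => (opRefl_of_ne r.2).symm

open Filter in
theorem omega_eventually_zero (hV : IsSmooth m V) (p : Fin N) (w : W N m V) :
    ∀ᶠ i : ℕ in atTop, omega p i w = 0 := by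
  obtain ⟨n, hn⟩ := gapTerm_eventually_zero hV p w
  filter_upwards [eventually_ge_atTop n] with i hi
  have h : (omega p i : Module.End ℂ (W N m V)) = opX p i * gapTerm p i := by
    rw [gapTerm_eq, ← mul_assoc, ← opX_add, add_neg_cancel, opX_zero, one_mul]
  rw [h, Module.End.mul_apply, hn i hi, map_zero]

/-- Any sufficiently large cutoff is allowed, so several such sums can be compared over one common
range. -/
theorem gap_eq_sum {hV : IsSmooth m V} {p : Fin N} {w : W N m V} {n : ℕ}
    (h : ∀ i : ℕ, n ≤ i → omega p i w = 0) :
    gap hV p w = ∑ i ∈ Finset.range n, opX p (-(i : ℤ)) (omega p i w) := by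
  change ∑ᶠ i : ℕ, gapTerm p i w = _
  rw [finsum_eq_sum_of_support_subset (s := Finset.range n)]
  · exact Finset.sum_congr rfl fun i _ => by rw [gapTerm_eq, Module.End.mul_apply]
  · intro i hi
    by_contra hin
    refine hi ?_
    change gapTerm p i w = 0
    rw [gapTerm_eq, Module.End.mul_apply, h i (by simpa using hin), map_zero]

theorem mul_gap_eq (hV : IsSmooth m V) {p q : Fin N} {φ : Module.End ℂ (W N m V)}
    (h : ∀ i : ℕ, φ * gapTerm p i = gapTerm q i * φ) : φ * gap hV p = gap hV q * φ := by
  refine LinearMap.ext fun w => ?_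
  change φ (∑ᶠ i : ℕ, gapTerm p i w) = ∑ᶠ i : ℕ, gapTerm q i (φ w)
  refine (AddMonoidHom.map_finsum φ.toAddMonoidHom (gapTerm_finite hV p w)).trans ?_
  exact finsum_congr fun i => LinearMap.congr_fun (h i) w

theorem gap_commute_opX (hV : IsSmooth m V) (p q : Fin N) (j : ℤ) :
    Commute (gap hV p) (opX q j) :=
  (mul_gap_eq hV fun i => by
    rw [gapTerm_eq]
    exact ((opX_commute p q _ j).mul_left (omega_commute_opX p q i j)).symm.eq).symm

theorem opS_mul_gap (hV : IsSmooth m V) (σ : Equiv.Perm (Fin N)) (p : Fin N) :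
    opS σ * gap hV p = gap hV (σ p) * opS σ :=
  mul_gap_eq hV fun i => by
    rw [gapTerm_eq, gapTerm_eq, ← mul_assoc, opS_mul_opX, mul_assoc, opS_mul_omega, mul_assoc]

theorem opS_mul_cherednikOp (κ : ℂ) (hV : IsSmooth m V) (σ : Equiv.Perm (Fin N)) (p : Fin N) :
    opS σ * cherednikOp κ hV p = cherednikOp κ hV (σ p) * opS σ := by
  rw [cherednikOp_eq, cherednikOp_eq, mul_add, mul_add, add_mul, add_mul, mul_smul_comm,
    smul_mul_assoc, opS_mul_opEuler, opS_mul_gap, Finset.mul_sum, Finset.sum_mul]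
  congr 2
  simp only [opS_mul_opRefl]
  -- The convention that the diagonal term is zero lets `r` run over all indices, so `σ` simply
  -- reindexes the sum.
  exact Equiv.sum_comp σ fun r => opRefl (σ p) r * opS σ

/-- Every part of `z_p` commutes with `x_q` except the divided difference for the pair `(p, q)`. -/
theorem cherednikOp_mul_opX_of_ne (κ : ℂ) (hV : IsSmooth m V) {p q : Fin N} (h : q ≠ p) :
    cherednikOp κ hV p * opX q 1 - opX q 1 * cherednikOp κ hV p
      = -(opX p 1 * opS (Equiv.swap p q)) := by
  have h1 : ∀ r ∈ Finset.univ.erase q, (opRefl p r * opX q 1 : Module.End ℂ (W N m V))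
      = opX q 1 * opRefl p r := fun r hr =>
    (opRefl_commute_opX h (Finset.ne_of_mem_erase hr).symm 1).eq
  rw [cherednikOp_eq, ← Finset.add_sum_erase _ _ (Finset.mem_univ q)]
  simp only [mul_add, add_mul, Finset.sum_mul, Finset.mul_sum, Finset.sum_congr rfl h1,
    smul_mul_assoc, mul_smul_comm, (opEuler_commute_opX h 1).eq, opRefl_mul_opX_right h,
    (gap_commute_opX hV p q 1).eq]
  abel

theorem cherednikOp_mul_opX_self (κ : ℂ) (hV : IsSmooth m V) (p : Fin N) :
    cherednikOp κ hV p * opX p 1 - opX p 1 * cherednikOp κ hV p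
      = κ • opX p 1 + ∑ r ∈ Finset.univ.filter (fun r => r ≠ p),
          opX p 1 * opS (Equiv.swap p r) := by
  have h1 : ∑ r, (opRefl p r * opX p 1 : Module.End ℂ (W N m V))
      = ∑ r, opX p 1 * opRefl p r + ∑ r ∈ Finset.univ.filter (fun r => r ≠ p),
          opX p 1 * opS (Equiv.swap p r) := by
    rw [Finset.sum_filter, ← Finset.sum_add_distrib]
    refine Finset.sum_congr rfl fun r _ => ?_
    rcases eq_or_ne r p with rfl | h
    · rw [opRefl_self, if_neg (not_not.mpr rfl), zero_mul, mul_zero, add_zero]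
    · rw [if_pos h, opRefl_mul_opX_left h]
  rw [cherednikOp_eq]
  simp only [mul_add, add_mul, Finset.sum_mul, Finset.mul_sum, h1,
    smul_mul_assoc, mul_smul_comm, opEuler_mul_opX, if_true, smul_add, Int.cast_one, one_smul,
    (gap_commute_opX hV p p 1).eq]
  abel

end Cherednik

/-! ### Consequences of the cross relations -/

section Abstract

variable {R ι : Type*} [Ring R] [DecidableEq ι] {x z : ι → R} {s : Equiv.Perm ι → R}

/-- Expanding with the cross relations, the terms with three distinct indices cancel by the
conjugation identities among `s_{pq}`, `s_{pr}` and `s_{qr}`. -/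
theorem cross_commute_of_ne (hmul : ∀ σ τ, s (σ * τ) = s σ * s τ)
    (hsx : ∀ σ p, s σ * x p = x (σ p) * s σ) (hsz : ∀ σ p, s σ * z p = z (σ p) * s σ)
    (hne : ∀ p q, q ≠ p → z p * x q - x q * z p = -(x p * s (Equiv.swap p q)))
    {p q r : ι} (hpq : q ≠ p) (hp : r ≠ p) (hq : r ≠ q) :
    Commute (z p * z q - z q * z p + (z p - z q) * s (Equiv.swap p q)) (x r) := by
  have assoc : ∀ {a b c : R}, a * b = c → ∀ w, a * (b * w) = c * w := fun h w => by
    rw [← mul_assoc, h]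
  have e1 : z p * x r = x r * z p - x p * s (Equiv.swap p r) := by
    rw [sub_eq_add_neg, ← hne p r hp]; abel
  have e2 : z q * x r = x r * z q - x q * s (Equiv.swap q r) := by
    rw [sub_eq_add_neg, ← hne q r hq]; abel
  have e3 : z p * x q = x q * z p - x p * s (Equiv.swap p q) := by
    rw [sub_eq_add_neg, ← hne p q hpq]; abel
  have e4 : z q * x p = x p * z q - x q * s (Equiv.swap p q) := by
    rw [sub_eq_add_neg, Equiv.swap_comm p q, ← hne q p hpq.symm]; abel
  have e5 : s (Equiv.swap p q) * x r = x r * s (Equiv.swap p q) := by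
    rw [hsx, Equiv.swap_apply_of_ne_of_ne hp hq]
  have e6 : s (Equiv.swap p r) * z q = z q * s (Equiv.swap p r) := by
    rw [hsz, Equiv.swap_apply_of_ne_of_ne hpq hq.symm]
  have e7 : s (Equiv.swap q r) * z p = z p * s (Equiv.swap q r) := by
    rw [hsz, Equiv.swap_apply_of_ne_of_ne hpq.symm hp.symm]
  have e8 : s (Equiv.swap q r) * s (Equiv.swap p q)
      = s (Equiv.swap p q) * s (Equiv.swap p r) := by
    rw [← hmul, ← hmul]
    congr 1
    have := Equiv.swap_apply_apply (Equiv.swap p q) p r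
    rw [Equiv.swap_apply_left, Equiv.swap_apply_of_ne_of_ne hp hq] at this
    rw [this, inv_mul_cancel_right]
  have e9 : s (Equiv.swap p r) * s (Equiv.swap p q)
      = s (Equiv.swap p q) * s (Equiv.swap q r) := by
    rw [← hmul, ← hmul]
    congr 1
    have := Equiv.swap_apply_apply (Equiv.swap p q) q r
    rw [Equiv.swap_apply_right, Equiv.swap_apply_of_ne_of_ne hp hq] at this
    rw [this, inv_mul_cancel_right]
  rw [Commute, SemiconjBy]
  -- The rules bring every monomial to the order `x`, then `z`, then permutations; the variants
  -- under `assoc` apply inside right-nested products. Only additive cancellation remains.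
  simp only [add_mul, sub_mul, mul_sub, mul_add, mul_assoc, e1, e2, e5, e6, e7, e8, e9,
    assoc e1, assoc e2, assoc e3, assoc e4]
  abel

variable [Algebra ℂ R] [Fintype ι] {κ : ℂ}

theorem cross_commute_left (hmul : ∀ σ τ, s (σ * τ) = s σ * s τ) (hone : s 1 = 1)
    (hsx : ∀ σ p, s σ * x p = x (σ p) * s σ) (hsz : ∀ σ p, s σ * z p = z (σ p) * s σ)
    (hne : ∀ p q, q ≠ p → z p * x q - x q * z p = -(x p * s (Equiv.swap p q)))
    (hself : ∀ p, z p * x p - x p * z p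
      = κ • x p + ∑ r ∈ Finset.univ.filter (fun r => r ≠ p), x p * s (Equiv.swap p r))
    {p q : ι} (hpq : q ≠ p) :
    Commute (z p * z q - z q * z p + (z p - z q) * s (Equiv.swap p q)) (x p) := by
  have assoc : ∀ {a b c : R}, a * b = c → ∀ w, a * (b * w) = c * w := fun h w => by
    rw [← mul_assoc, h]
  -- The reflections away from the pair are kept as one block: `S p q` commutes with `z q`, and
  -- `s_{pq}` conjugates `S p q` to `S q p`. No expansion over `r` is then needed in the final
  -- computation.
  set S := fun a b : ι => ∑ r ∈ Finset.univ.filter (fun r => r ≠ a ∧ r ≠ b), s (Equiv.swap a r)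
    with hS
  have hself' : ∀ a b : ι, b ≠ a →
      z a * x a = x a * z a + κ • x a + x a * s (Equiv.swap a b) + x a * S a b := by
    intro a b hab
    have h1 : Finset.univ.filter (fun r => r ≠ a)
        = insert b (Finset.univ.filter (fun r => r ≠ a ∧ r ≠ b)) := by
      ext r
      by_cases hr : r = b <;> simp [hr, hab]
    have h2 := hself a
    rw [h1, Finset.sum_insert (by simp), ← Finset.mul_sum, sub_eq_iff_eq_add] at h2
    rw [h2]
    abel
  have e1 : z p * x q = x q * z p - x p * s (Equiv.swap p q) := by
    rw [sub_eq_add_neg, ← hne p q hpq]; abel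
  have e2 : z q * x p = x p * z q - x q * s (Equiv.swap p q) := by
    rw [sub_eq_add_neg, Equiv.swap_comm p q, ← hne q p hpq.symm]; abel
  have e3 := hself' p q hpq
  have e4 := hself' q p hpq.symm
  rw [Equiv.swap_comm q p] at e4
  have e5 : s (Equiv.swap p q) * x p = x q * s (Equiv.swap p q) := by
    rw [hsx, Equiv.swap_apply_left]
  have e6 : s (Equiv.swap p q) * z p = z q * s (Equiv.swap p q) := by
    rw [hsz, Equiv.swap_apply_left]
  have e7 : s (Equiv.swap p q) * z q = z p * s (Equiv.swap p q) := by
    rw [hsz, Equiv.swap_apply_right]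
  have e8 : S p q * z q = z q * S p q := by
    rw [hS, Finset.sum_mul, Finset.mul_sum]
    refine Finset.sum_congr rfl fun r hr => ?_
    simp only [Finset.mem_filter] at hr
    rw [hsz, Equiv.swap_apply_of_ne_of_ne hpq hr.2.2.symm]
  have e9 : S q p * s (Equiv.swap p q) = s (Equiv.swap p q) * S p q := by
    rw [hS, Finset.sum_mul, Finset.mul_sum]
    refine Finset.sum_congr (by ext r; simp [and_comm]) fun r hr => ?_
    simp only [Finset.mem_filter] at hr
    rw [← hmul, ← hmul]
    congr 1
    have := Equiv.swap_apply_apply (Equiv.swap p q) p r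
    rw [Equiv.swap_apply_left, Equiv.swap_apply_of_ne_of_ne hr.2.1 hr.2.2] at this
    rw [this, inv_mul_cancel_right]
  have e10 : s (Equiv.swap p q) * s (Equiv.swap p q) = 1 := by
    rw [← hmul, Equiv.swap_mul_self, hone]
  rw [Commute, SemiconjBy]
  simp only [add_mul, sub_mul, mul_sub, mul_add, mul_assoc, smul_mul_assoc, mul_smul_comm,
    smul_sub, e2, e3, e5, e6, e7, e8, e9, e10, assoc e1, assoc e2, assoc e3, assoc e4, mul_one]
  abel

theorem cross_commute (hmul : ∀ σ τ, s (σ * τ) = s σ * s τ) (hone : s 1 = 1)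
    (hsx : ∀ σ p, s σ * x p = x (σ p) * s σ) (hsz : ∀ σ p, s σ * z p = z (σ p) * s σ)
    (hne : ∀ p q, q ≠ p → z p * x q - x q * z p = -(x p * s (Equiv.swap p q)))
    (hself : ∀ p, z p * x p - x p * z p
      = κ • x p + ∑ r ∈ Finset.univ.filter (fun r => r ≠ p), x p * s (Equiv.swap p r))
    {p q : ι} (hpq : q ≠ p) (r : ι) :
    Commute (z p * z q - z q * z p + (z p - z q) * s (Equiv.swap p q)) (x r) := by
  rcases eq_or_ne r p with rfl | hp
  · exact cross_commute_left hmul hone hsx hsz hne hself hpq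
  rcases eq_or_ne r q with rfl | hq
  · have := (cross_commute_left hmul hone hsx hsz hne hself hpq.symm).neg_left
    rw [Equiv.swap_comm] at this
    convert this using 1
    noncomm_ring
  · exact cross_commute_of_ne hmul hsx hsz hne hpq hp hq

end Abstract

/-! ### Jucys–Murphy elements: from the `z_p` to the commuting `u_p` -/

section JucysMurphy

variable {R : Type*} [Ring R] {N : ℕ} {z : Fin N → R} {s : Equiv.Perm (Fin N) → R}

/-- The Jucys–Murphy element `∑_{r < q} σ_{rq}`. -/
def jucysMurphy (s : Equiv.Perm (Fin N) → R) (q : Fin N) : R :=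
  ∑ r ∈ Finset.univ.filter (fun r => r < q), s (Equiv.swap r q)

theorem perm_mul_jucysMurphy (hmul : ∀ σ τ, s (σ * τ) = s σ * s τ) (σ : Equiv.Perm (Fin N))
    {q : Fin N} (h : ∀ r, r < q ↔ σ r < q) (hq : σ q = q) :
    s σ * jucysMurphy s q = jucysMurphy s q * s σ := by
  rw [jucysMurphy, Finset.mul_sum, Finset.sum_mul]
  refine Finset.sum_equiv σ (fun r => by simpa using h r) fun r _ => ?_
  rw [← hmul, ← hmul]
  congr 1
  have := Equiv.swap_apply_apply σ r q
  rw [hq] at this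
  rw [this, inv_mul_cancel_right]

theorem perm_mul_far (hmul : ∀ σ τ, s (σ * τ) = s σ * s τ)
    (hsz : ∀ σ p, s σ * z p = z (σ p) * s σ) {p p' q : Fin N} (hp : (p' : ℕ) = p + 1)
    (hq : q ≠ p) (hq' : q ≠ p') :
    s (Equiv.swap p p') * (z q + jucysMurphy s q)
      = (z q + jucysMurphy s q) * s (Equiv.swap p p') := by
  have hfix : Equiv.swap p p' q = q := Equiv.swap_apply_of_ne_of_ne hq hq'
  rw [mul_add, add_mul, hsz, hfix, perm_mul_jucysMurphy hmul _ (fun r => ?_) hfix]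
  have h1 : (q : ℕ) ≠ p := fun h => hq (Fin.ext h)
  have h2 : (q : ℕ) ≠ p' := fun h => hq' (Fin.ext h)
  rw [Equiv.swap_apply_def]
  split_ifs with h3 h4
  · subst h3; rw [Fin.lt_def, Fin.lt_def]; omega
  · subst h4; rw [Fin.lt_def, Fin.lt_def]; omega
  · rfl

/-- The Jucys–Murphy sum for `p'` has one summand more than that for `p`, namely `s_{pp'}`; its
square is the `1` being subtracted. -/
theorem perm_mul_near (hmul : ∀ σ τ, s (σ * τ) = s σ * s τ) (hone : s 1 = 1)
    (hsz : ∀ σ p, s σ * z p = z (σ p) * s σ) {p p' : Fin N} (hp : (p' : ℕ) = p + 1) :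
    s (Equiv.swap p p') * (z p + jucysMurphy s p)
      = (z p' + jucysMurphy s p') * s (Equiv.swap p p') - 1 := by
  have h1 : Finset.univ.filter (fun r => r < p')
      = insert p (Finset.univ.filter (fun r => r < p)) := by
    ext r
    simp only [Finset.mem_filter, Finset.mem_univ, true_and, Finset.mem_insert, Fin.lt_def,
      Fin.ext_iff]
    omega
  have h2 : ∑ r ∈ Finset.univ.filter (fun r => r < p), s (Equiv.swap p p') * s (Equiv.swap r p)
      = ∑ r ∈ Finset.univ.filter (fun r => r < p),
          s (Equiv.swap r p') * s (Equiv.swap p p') := by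
    refine Finset.sum_congr rfl fun r hr => ?_
    simp only [Finset.mem_filter, Finset.mem_univ, true_and] at hr
    rw [← hmul, ← hmul]
    congr 1
    have hr' : r ≠ p' := by
      rintro rfl
      rw [Fin.lt_def] at hr
      omega
    have := Equiv.swap_apply_apply (Equiv.swap p p') r p
    rw [Equiv.swap_apply_left, Equiv.swap_apply_of_ne_of_ne hr.ne hr'] at this
    rw [this, inv_mul_cancel_right]
  rw [mul_add, add_mul, hsz, Equiv.swap_apply_left, jucysMurphy, jucysMurphy, h1,
    Finset.sum_insert (by simp), add_mul, ← hmul, Equiv.swap_mul_self, hone, Finset.mul_sum,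
    Finset.sum_mul, h2]
  abel

/-- For `p < q` the Jucys–Murphy element of `p` commutes with that of `q` and with `z_q`. Hence
`[u_p, u_q]` is exactly the expression assumed to vanish. -/
theorem add_jucysMurphy_commute_of_lt (hmul : ∀ σ τ, s (σ * τ) = s σ * s τ)
    (hsz : ∀ σ p, s σ * z p = z (σ p) * s σ)
    (hzz : ∀ p q, q ≠ p → z p * z q - z q * z p + (z p - z q) * s (Equiv.swap p q) = 0)
    {p q : Fin N} (h : p < q) :
    Commute (z p + jucysMurphy s p) (z q + jucysMurphy s q) := by
  have h1 : jucysMurphy s p * jucysMurphy s q = jucysMurphy s q * jucysMurphy s p := by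
    conv_lhs => rw [jucysMurphy]
    conv_rhs => rw [jucysMurphy.eq_def s p]
    rw [Finset.sum_mul, Finset.mul_sum]
    refine Finset.sum_congr rfl fun r hr => ?_
    simp only [Finset.mem_filter, Finset.mem_univ, true_and] at hr
    refine perm_mul_jucysMurphy hmul _ (fun t => ?_)
      (Equiv.swap_apply_of_ne_of_ne (hr.trans h).ne' h.ne')
    rw [Equiv.swap_apply_def]
    split_ifs with h3 h4
    · subst h3; exact iff_of_true (hr.trans h) h
    · subst h4; exact iff_of_true h (hr.trans h)
    · rfl
  have h2 : jucysMurphy s p * z q = z q * jucysMurphy s p := by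
    rw [jucysMurphy, Finset.sum_mul, Finset.mul_sum]
    refine Finset.sum_congr rfl fun r hr => ?_
    simp only [Finset.mem_filter, Finset.mem_univ, true_and] at hr
    rw [hsz, Equiv.swap_apply_of_ne_of_ne (hr.trans h).ne' h.ne']
  -- Among the transpositions `(r q)` with `r < q`, only the one with `r = p` moves `z p`.
  have h3 : jucysMurphy s q * z p = z p * jucysMurphy s q + (z q - z p) * s (Equiv.swap p q) := by
    have hp : p ∈ Finset.univ.filter (fun r => r < q) := by simpa using h
    rw [jucysMurphy, ← Finset.add_sum_erase _ _ hp, add_mul, mul_add, hsz, Equiv.swap_apply_left,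
      Finset.sum_mul, Finset.mul_sum, sub_mul]
    have h4 : ∀ r ∈ (Finset.univ.filter (fun r => r < q)).erase p,
        s (Equiv.swap r q) * z p = z p * s (Equiv.swap r q) := by
      intro r hr
      rw [hsz, Equiv.swap_apply_of_ne_of_ne (Finset.ne_of_mem_erase hr).symm h.ne]
    rw [Finset.sum_congr rfl h4]
    abel
  have h5 := hzz p q h.ne'
  rw [Commute, SemiconjBy, ← sub_eq_zero, ← h5, mul_add, add_mul, add_mul, mul_add, add_mul,
    add_mul, h1, h2, h3]
  noncomm_ring

theorem add_jucysMurphy_commute (hmul : ∀ σ τ, s (σ * τ) = s σ * s τ)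
    (hsz : ∀ σ p, s σ * z p = z (σ p) * s σ)
    (hzz : ∀ p q, q ≠ p → z p * z q - z q * z p + (z p - z q) * s (Equiv.swap p q) = 0)
    (p q : Fin N) : Commute (z p + jucysMurphy s p) (z q + jucysMurphy s q) := by
  rcases lt_trichotomy p q with h | rfl | h
  · exact add_jucysMurphy_commute_of_lt hmul hsz hzz h
  · exact Commute.refl _
  · exact (add_jucysMurphy_commute_of_lt hmul hsz hzz h).symm

end JucysMurphy

/-! ### The commutator of two Cherednik operators -/

/-- Regroups a square sum along `i + j = k`, isolating the endpoint `j = 0`; the primed version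
isolates `i = 0`. The geometric sums cover each antidiagonal except such an endpoint. -/
theorem sum_range_sum_range_eq {M : Type*} [AddCommMonoid M] {n : ℕ} (f : ℕ → ℕ → M)
    (hf : ∀ i j, n ≤ i + j → f i j = 0) :
    ∑ i ∈ Finset.range n, ∑ j ∈ Finset.range n, f i j
      = ∑ k ∈ Finset.range n, (∑ c ∈ Finset.range k, f c (k - c) + f k 0) := by
  have h1 : ∀ i, ∑ j ∈ Finset.range n, f i j = ∑ j ∈ Finset.range (n - i), f i j := by
    intro i
    refine (Finset.sum_subset (Finset.range_subset_range.mpr (Nat.sub_le _ _)) ?_).symm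
    intro j _ hj
    refine hf i j ?_
    rw [Finset.mem_range] at hj
    omega
  simp only [h1, ← Finset.sum_range_diag_flip, Finset.sum_range_succ, Nat.sub_self]

theorem sum_range_sum_range_eq' {M : Type*} [AddCommMonoid M] {n : ℕ} (f : ℕ → ℕ → M)
    (hf : ∀ i j, n ≤ i + j → f i j = 0) :
    ∑ i ∈ Finset.range n, ∑ j ∈ Finset.range n, f i j
      = ∑ k ∈ Finset.range n, (∑ c ∈ Finset.range k, f (k - c) c + f 0 k) := by
  rw [Finset.sum_comm]
  exact sum_range_sum_range_eq (fun i j => f j i) fun i j h => hf j i (by omega)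

/-! ### Reduction to vectors with constant polynomial part -/

section Constants

variable {N m : ℕ} {V : Type*} [AddCommGroup V] [Module ℂ V]

variable (N m V) in
/-- The subspace `1 ⊗ (ℂ^m)^{⊗N} ⊗ V` of `W`. -/
def constW : Submodule ℂ (W N m V) :=
  Submodule.span ℂ {w | ∃ (g : Tens N m) (v : V), w = W.tmul 1 g v}

theorem tmul_mem_constW (g : Tens N m) (v : V) : W.tmul 1 g v ∈ constW N m V :=
  Submodule.subset_span ⟨g, v, rfl⟩

theorem constW_ext {φ ψ : Module.End ℂ (W N m V)}
    (h : ∀ g v, φ (W.tmul 1 g v) = ψ (W.tmul 1 g v)) {w : W N m V} (hw : w ∈ constW N m V) :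
    φ w = ψ w := by
  refine LinearMap.eqOn_span' (f := φ) (g := ψ) ?_ hw
  rintro _ ⟨g, v, rfl⟩
  exact h g v

theorem op_mem_constW (g : Module.End ℂ (Tens N m)) (h : Module.End ℂ V) {w : W N m V}
    (hw : w ∈ constW N m V) : op LinearMap.id g h w ∈ constW N m V := by
  refine Submodule.span_induction (p := fun w _ => op LinearMap.id g h w ∈ constW N m V)
    ?_ ?_ ?_ ?_ hw
  · rintro _ ⟨x, v, rfl⟩
    rw [op_tmul]
    exact tmul_mem_constW _ _
  · rw [map_zero]
    exact zero_mem _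
  · intro x y _ _ hx hy
    rw [map_add]
    exact add_mem hx hy
  · intro c x _ hx
    rw [map_smul]
    exact Submodule.smul_mem _ _ hx

/-- Commuting with `x_p` implies commuting with its inverse, so `φ` is linear over Laurent
polynomials, over which the constant vectors generate `W`. -/
theorem eq_zero_of_commute_opX {φ : Module.End ℂ (W N m V)} (hφ : ∀ p, Commute φ (opX p 1))
    (h : ∀ w ∈ constW N m V, φ w = 0) : φ = 0 := by
  have hinv : ∀ p, Commute φ (opX p (-1)) := by
    intro p
    have h1 : (opX p 1 * opX p (-1) : Module.End ℂ (W N m V)) = 1 := by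
      rw [← opX_add, add_neg_cancel, opX_zero]
    have h2 : (opX p (-1) * opX p 1 : Module.End ℂ (W N m V)) = 1 := by
      rw [← opX_add, neg_add_cancel, opX_zero]
    calc φ * opX p (-1) = opX p (-1) * (opX p 1 * φ) * opX p (-1) := by
          rw [← mul_assoc, h2, one_mul]
      _ = opX p (-1) * φ := by rw [← (hφ p).eq, mul_assoc, mul_assoc, h1, mul_one]
  have hall : ∀ p j, Commute φ (opX p j) := by
    intro p j
    induction j using Int.induction_on with
    | zero => rw [opX_zero]; exact Commute.one_right _
    | succ j ih => rw [opX_add]; exact ih.mul_right (hφ p)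
    | pred j ih => rw [sub_eq_add_neg, opX_add]; exact ih.mul_right (hinv p)
  refine W.hom_ext fun f g v => ?_
  rw [LinearMap.zero_apply]
  induction f using induction_xpow with
  | zero =>
    have : W.tmul (0 : Laurent N) g v = 0 := by
      simpa using W.smul_tmul (0 : ℂ) (0 : Laurent N) g v
    rw [this, map_zero]
  | add f f' hf hf' => rw [W.add_tmul, map_add, hf, hf', add_zero]
  | smul c f hf => rw [W.smul_tmul, map_smul, hf, smul_zero]
  | one => exact h _ (tmul_mem_constW g v)
  | mul p j f hf =>
    have h1 : W.tmul (xpow p j * f) g v = opX p j (W.tmul f g v) := by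
      rw [opX, op_tmul]
      rfl
    rw [h1, ← Module.End.mul_apply, (hall p j).eq, Module.End.mul_apply, hf, map_zero]

/-- Multiplication by a Laurent polynomial on `W`. -/
def opMul : Laurent N →ₗ[ℂ] Module.End ℂ (W N m V) where
  toFun f := op (LinearMap.mulLeft ℂ f) LinearMap.id LinearMap.id
  map_add' f f' := by
    rw [← op_add_left]
    congr 1
    exact LinearMap.ext fun g => add_mul _ _ _
  map_smul' c f := by
    rw [RingHom.id_apply, ← op_smul_left]
    congr 1
    exact LinearMap.ext fun g => smul_mul_assoc _ _ _

theorem opMul_apply (f : Laurent N) : (opMul f : Module.End ℂ (W N m V))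
    = op (LinearMap.mulLeft ℂ f) LinearMap.id LinearMap.id := rfl

theorem opMul_xpow_mul (p r : Fin N) (i j : ℤ) :
    (opMul (xpow p i * xpow r j) : Module.End ℂ (W N m V)) = opX p i * opX r j := by
  rw [opMul_apply, opX, opX, op_mul, mulX, mulX, mulLeft_mul_mulLeft]
  rfl

theorem opMul_divDiff {p r : Fin N} (h : r ≠ p) (j : ℕ) :
    (opMul (xpow p 1 * divDiff h (xpow r (-(j : ℤ)))) : Module.End ℂ (W N m V))
      = ∑ b ∈ Finset.range j, opX p (-(b : ℤ)) * opX r ((b : ℤ) - j) := by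
  rw [xpow_mul_divDiff_neg, map_sum]
  simp only [opMul_xpow_mul]

theorem opEuler_apply_const (p : Fin N) {w : W N m V} (hw : w ∈ constW N m V) :
    opEuler p w = 0 := by
  refine constW_ext (φ := opEuler p) (ψ := 0) (fun g v => ?_) hw
  rw [opEuler, op_tmul, euler_one, LinearMap.zero_apply]
  simpa using W.smul_tmul (0 : ℂ) (0 : Laurent N) g v

theorem opRefl_apply_const (p r : Fin N) {w : W N m V} (hw : w ∈ constW N m V) :
    opRefl p r w = 0 := by
  rcases eq_or_ne r p with rfl | h
  · rw [opRefl_self, LinearMap.zero_apply]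
  refine constW_ext (φ := opRefl p r) (ψ := 0) (fun g v => ?_) hw
  rw [opRefl_of_ne h, op_tmul, Module.End.mul_apply, divDiff_one, map_zero, LinearMap.zero_apply]
  simpa using W.smul_tmul (0 : ℂ) (0 : Laurent N) (tensPerm m (Equiv.swap p r) g) v

/-- On a constant vector the divided difference only sees the monomial, so `xpow_mul_divDiff_neg`
evaluates it. -/
theorem opRefl_opX_apply_const {p q : Fin N} (h : q ≠ p) (i : ℕ) {w : W N m V}
    (hw : w ∈ constW N m V) :
    opRefl p q (opX q (-(i : ℤ)) w)
      = ∑ b ∈ Finset.range i,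
          opX p (-(b : ℤ)) (opX q ((b : ℤ) - i) (opP (Equiv.swap p q) w)) := by
  have h1 := constW_ext (φ := opRefl p q * opX q (-(i : ℤ)))
    (ψ := opMul (xpow p 1 * divDiff h (xpow q (-(i : ℤ)))) * opP (Equiv.swap p q))
    (fun g v => ?_) hw
  · rw [opMul_divDiff, Module.End.mul_apply, Module.End.mul_apply, LinearMap.sum_apply] at h1
    exact h1
  · rw [opRefl_of_ne h, opX, opMul_apply, opP, op_mul, op_mul, op_tmul, op_tmul]
    simp only [Module.End.mul_apply, mulX_apply, mul_one, LinearMap.id_apply,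
      LinearMap.mulLeft_apply]

theorem opS_apply_const (σ : Equiv.Perm (Fin N)) {w : W N m V} (hw : w ∈ constW N m V) :
    opS σ w = opP σ w := by
  refine constW_ext (fun g v => ?_) hw
  rw [opS, opP, op_tmul, op_tmul, AlgHom.toLinearMap_apply, map_one]
  rfl

theorem opP_mem_constW (σ : Equiv.Perm (Fin N)) {w : W N m V} (hw : w ∈ constW N m V) :
    opP σ w ∈ constW N m V := op_mem_constW _ _ hw

variable [LieRingModule (Affine m) V] [LieModule ℂ (Affine m) V]

theorem omega_mem_constW (p : Fin N) (k : ℤ) {w : W N m V} (hw : w ∈ constW N m V) :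
    omega p k w ∈ constW N m V := by
  simp only [omega, LinearMap.sum_apply, Module.End.mul_apply]
  exact Submodule.sum_mem _ fun a _ => Submodule.sum_mem _ fun b _ =>
    op_mem_constW _ _ (op_mem_constW _ _ hw)

theorem cherednikOp_apply_const (κ : ℂ) (hV : IsSmooth m V) (p : Fin N) {w : W N m V}
    (hw : w ∈ constW N m V) : cherednikOp κ hV p w = gap hV p w := by
  simp only [cherednikOp_eq, LinearMap.add_apply, LinearMap.smul_apply, LinearMap.sum_apply,
    opEuler_apply_const p hw, opRefl_apply_const p _ hw, smul_zero, Finset.sum_const_zero, zero_add]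

theorem cherednikOp_opX_apply_const (κ : ℂ) (hV : IsSmooth m V) {p q : Fin N} (h : q ≠ p) (i : ℕ)
    {w : W N m V} (hw : w ∈ constW N m V) :
    cherednikOp κ hV p (opX q (-(i : ℤ)) w) = opX q (-(i : ℤ)) (gap hV p w)
      + ∑ b ∈ Finset.range i,
          opX p (-(b : ℤ)) (opX q ((b : ℤ) - i) (opP (Equiv.swap p q) w)) := by
  have h1 : ∑ r, opRefl p r (opX q (-(i : ℤ)) w) = opRefl p q (opX q (-(i : ℤ)) w) := by
    refine Finset.sum_eq_single q (fun r _ hr => ?_) (by simp)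
    rw [← Module.End.mul_apply, (opRefl_commute_opX h hr.symm _).eq, Module.End.mul_apply,
      opRefl_apply_const p r hw, map_zero]
  have h2 : opEuler p (opX q (-(i : ℤ)) w) = 0 := by
    rw [← Module.End.mul_apply, (opEuler_commute_opX h _).eq, Module.End.mul_apply,
      opEuler_apply_const p hw, map_zero]
  have h3 : gap hV p (opX q (-(i : ℤ)) w) = opX q (-(i : ℤ)) (gap hV p w) := by
    rw [← Module.End.mul_apply, (gap_commute_opX hV p q _).eq, Module.End.mul_apply]
  simp only [cherednikOp_eq, LinearMap.add_apply, LinearMap.smul_apply, LinearMap.sum_apply, h1, h2,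
    h3, opRefl_opX_apply_const h i hw, smul_zero, zero_add]
  rw [add_comm]

-- The cutoff for `j` is uniform in `i`, because `omega q i w` is nonzero for only finitely many
-- `i`.
open Filter in
theorem omega_omega_eventually_zero (hV : IsSmooth m V) (p q : Fin N) (w : W N m V) :
    ∀ᶠ j : ℕ in atTop, ∀ i : ℕ, omega p j (omega q i w) = 0 := by
  obtain ⟨n, hn⟩ := eventually_atTop.mp (omega_eventually_zero hV q w)
  have h := (Finset.range n).eventually_all.mpr fun i _ =>
    omega_eventually_zero hV p (omega q i w)
  filter_upwards [h] with j hj i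
  rcases lt_or_ge i n with hi | hi
  · exact hj i (Finset.mem_range.mpr hi)
  · rw [hn i hi, map_zero]

theorem cherednikOp_cherednikOp_apply (κ : ℂ) (hV : IsSmooth m V) {p q : Fin N} (h : q ≠ p)
    {w : W N m V} (hw : w ∈ constW N m V) {n : ℕ} (hq : ∀ i : ℕ, n ≤ i → omega q i w = 0)
    (hpq : ∀ j : ℕ, n ≤ j → ∀ i : ℕ, omega p j (omega q i w) = 0) :
    cherednikOp κ hV p (cherednikOp κ hV q w)
      = ∑ i ∈ Finset.range n, ∑ j ∈ Finset.range n,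
          (opX q (-(i : ℤ)) * opX p (-(j : ℤ)) : Module.End ℂ (W N m V)) (omega p j (omega q i w))
        + ∑ i ∈ Finset.range n, ∑ b ∈ Finset.range i,
          (opX q (-((i - b : ℕ) : ℤ)) * opX p (-(b : ℤ)) : Module.End ℂ (W N m V))
            (opP (Equiv.swap p q) (omega q i w)) := by
  rw [cherednikOp_apply_const κ hV q hw, gap_eq_sum hq, map_sum, ← Finset.sum_add_distrib]
  refine Finset.sum_congr rfl fun i _ => ?_
  rw [cherednikOp_opX_apply_const κ hV h i (omega_mem_constW q i hw),
    gap_eq_sum fun j hj => hpq j hj i, map_sum]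
  congr 1
  refine Finset.sum_congr rfl fun b hb => ?_
  have h1 : (-((i - b : ℕ) : ℤ)) = b - i := by
    rw [Nat.cast_sub (Finset.mem_range.mp hb).le]
    ring
  rw [h1, (opX_commute q p _ _).eq, Module.End.mul_apply]

theorem cherednikOp_commutator (κ : ℂ) (hV : IsSmooth m V) {p q : Fin N} (h : q ≠ p) :
    cherednikOp κ hV p * cherednikOp κ hV q - cherednikOp κ hV q * cherednikOp κ hV p
      + (cherednikOp κ hV p - cherednikOp κ hV q) * opS (Equiv.swap p q)
      = (0 : Module.End ℂ (W N m V)) := by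
  refine eq_zero_of_commute_opX (fun r => ?_) fun w hw => ?_
  · exact cross_commute (x := fun p => opX p 1) (s := opS) opS_mul opS_one
      (fun σ p => opS_mul_opX σ p 1) (opS_mul_cherednikOp κ hV)
      (fun _ _ h => cherednikOp_mul_opX_of_ne κ hV h) (cherednikOp_mul_opX_self κ hV) h r
  obtain ⟨n, hn⟩ := Filter.eventually_atTop.mp ((omega_eventually_zero hV p w).and
    ((omega_eventually_zero hV q w).and ((omega_omega_eventually_zero hV p q w).and
      (omega_omega_eventually_zero hV q p w))))
  have hp : ∀ i : ℕ, n ≤ i → omega p i w = 0 := fun i hi => (hn i hi).1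
  have hq : ∀ i : ℕ, n ≤ i → omega q i w = 0 := fun i hi => (hn i hi).2.1
  have hP : ∀ i : ℕ, omega p i (opP (Equiv.swap p q) w) = opP (Equiv.swap p q) (omega q i w) := by
    intro i
    rw [← Module.End.mul_apply, ← Module.End.mul_apply, opP_mul_omega, Equiv.swap_apply_right]
  have hQ : ∀ i : ℕ, omega q i (opP (Equiv.swap p q) w) = opP (Equiv.swap p q) (omega p i w) := by
    intro i
    rw [← Module.End.mul_apply, ← Module.End.mul_apply, opP_mul_omega, Equiv.swap_apply_left]
  have hPw := opP_mem_constW (Equiv.swap p q) hw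
  simp only [LinearMap.add_apply, LinearMap.sub_apply, Module.End.mul_apply,
    opS_apply_const _ hw, cherednikOp_apply_const κ hV _ hPw]
  rw [cherednikOp_cherednikOp_apply κ hV h hw hq fun j hj => (hn j hj).2.2.1,
    cherednikOp_cherednikOp_apply κ hV h.symm hw hp fun j hj => (hn j hj).2.2.2,
    gap_eq_sum (n := n) fun i hi => by rw [hP, hq i hi, map_zero],
    gap_eq_sum (n := n) fun i hi => by rw [hQ, hp i hi, map_zero], Equiv.swap_comm q p]
  simp only [hP, hQ]
  set e : ℕ → ℕ → Module.End ℂ (W N m V) := fun i j => opX q (-(i : ℤ)) * opX p (-(j : ℤ)) with he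
  set a : ℕ → W N m V := fun k => opP (Equiv.swap p q) (omega p k w) with ha
  set b : ℕ → W N m V := fun k => opP (Equiv.swap p q) (omega q k w) with hb
  have ha0 : ∀ k, n ≤ k → a k = 0 := fun k hk => by simp only [ha, hp k hk, map_zero]
  have hb0 : ∀ k, n ≤ k → b k = 0 := fun k hk => by simp only [hb, hq k hk, map_zero]
  -- Both exponents are natural numbers, so they can be opposite only when both vanish, and no
  -- central term appears.
  have key : ∀ i j : ℕ, e i j (omega p j (omega q i w)) - e i j (omega q i (omega p j w))
      = e i j (a (i + j)) - e i j (b (i + j)) := by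
    intro i j
    have h1 := LinearMap.congr_fun
      (omega_mul_omega_sub (V := V) h (i : ℤ) (j : ℤ) (by omega)) w
    rw [← map_sub, ← map_sub]
    congr 1
    simpa [mul_sub, ha, hb] using h1
  -- The endpoint is chosen to match what remains: the `a`-terms leave out `x_q^{-k}`, supplied by
  -- `gap hV q` on the swapped vector, and the `b`-terms leave out `x_p^{-k}`, supplied by `gap hV
  -- p`.
  have hA := sum_range_sum_range_eq (n := n) (fun i j => e i j (a (i + j))) fun i j hij => by
    simp only [ha0 _ hij, map_zero]
  have hB := sum_range_sum_range_eq' (n := n) (fun i j => e i j (b (i + j))) fun i j hij => by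
    simp only [hb0 _ hij, map_zero]
  have hmain : ∑ i ∈ Finset.range n, ∑ j ∈ Finset.range n, e i j (omega p j (omega q i w))
      - ∑ i ∈ Finset.range n, ∑ j ∈ Finset.range n, e i j (omega q i (omega p j w))
      = ∑ i ∈ Finset.range n, ∑ j ∈ Finset.range n, e i j (a (i + j))
        - ∑ i ∈ Finset.range n, ∑ j ∈ Finset.range n, e i j (b (i + j)) := by
    simp only [← Finset.sum_sub_distrib, key]
  have hswap : ∑ i ∈ Finset.range n, ∑ j ∈ Finset.range n,
        (opX p (-(i : ℤ)) * opX q (-(j : ℤ)) : Module.End ℂ (W N m V))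
          (omega q j (omega p i w))
      = ∑ i ∈ Finset.range n, ∑ j ∈ Finset.range n, e i j (omega q i (omega p j w)) := by
    rw [Finset.sum_comm]
    refine Finset.sum_congr rfl fun i _ => Finset.sum_congr rfl fun j _ => ?_
    rw [(opX_commute p q _ _).eq]
  have hA' : ∑ k ∈ Finset.range n, (∑ c ∈ Finset.range k, e c (k - c) (a (c + (k - c)))
        + e k 0 (a (k + 0)))
      = ∑ k ∈ Finset.range n, ∑ c ∈ Finset.range k,
          (opX p (-((k - c : ℕ) : ℤ)) * opX q (-(c : ℤ)) : Module.End ℂ (W N m V)) (a k)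
        + ∑ k ∈ Finset.range n, opX q (-(k : ℤ)) (a k) := by
    rw [← Finset.sum_add_distrib]
    refine Finset.sum_congr rfl fun k _ => ?_
    congr 1
    · refine Finset.sum_congr rfl fun c hc => ?_
      rw [Nat.add_sub_of_le (Finset.mem_range.mp hc).le, (opX_commute p q _ _).eq]
    · simp [he, opX_zero]
  have hB' : ∑ k ∈ Finset.range n, (∑ c ∈ Finset.range k, e (k - c) c (b (k - c + c))
        + e 0 k (b (0 + k)))
      = ∑ k ∈ Finset.range n, ∑ c ∈ Finset.range k, e (k - c) c (b k)
        + ∑ k ∈ Finset.range n, opX p (-(k : ℤ)) (b k) := by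
    rw [← Finset.sum_add_distrib]
    refine Finset.sum_congr rfl fun k _ => ?_
    congr 1
    · refine Finset.sum_congr rfl fun c hc => ?_
      rw [Nat.sub_add_cancel (Finset.mem_range.mp hc).le]
    · simp [he, opX_zero]
  rw [hA'] at hA
  rw [hB'] at hB
  rw [hA, hB] at hmain
  rw [hswap, sub_eq_iff_eq_add.mp hmain]
  abel

end Constants

/-! ### The commutator of a Cherednik operator with the affine Lie algebra -/

/-- The nonnegative range cancels against its shift, leaving only the values of `H` at `-j, …, -1`.
-/
theorem sum_range_sub_shift {M : Type*} [AddCommGroup M] (H : ℤ → M) (j n : ℕ)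
    (hH : ∀ k : ℕ, n ≤ k → H k = 0) :
    ∑ i ∈ Finset.range (n + j), (H i - H (i - j)) = -∑ i ∈ Finset.range j, H (i - j) := by
  have h1 : ∑ i ∈ Finset.range (n + j), H i = ∑ i ∈ Finset.range n, H i := by
    rw [Finset.sum_range_add]
    rw [Finset.sum_eq_zero fun i _ => hH (n + i) (Nat.le_add_right n i), add_zero]
  have h2 : ∑ i ∈ Finset.range (n + j), H (i - j)
      = ∑ i ∈ Finset.range j, H (i - j) + ∑ i ∈ Finset.range n, H i := by
    rw [add_comm n, Finset.sum_range_add]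
    congr 1
    refine Finset.sum_congr rfl fun i _ => ?_
    congr 1
    push_cast
    ring
  rw [Finset.sum_sub_distrib, h1, h2]
  abel

section AffineCommutator

variable {N m : ℕ} {V : Type*} [AddCommGroup V] [Module ℂ V]

/-- The twisted Leibniz rule on `W`: the reflection moves the loop action from site `q` to the
swapped site, with an error given by the divided difference of the monomial. -/
theorem opRefl_mul_opX_opF {p r : Fin N} (h : r ≠ p) (q : Fin N) (j : ℤ) (A : Mat m) :
    (opRefl p r * (opX q j * opF q A) : Module.End ℂ (W N m V))
      = opX (Equiv.swap p r q) j * opF (Equiv.swap p r q) A * opRefl p r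
        + opMul (xpow p 1 * divDiff h (xpow q j)) * (opP (Equiv.swap p r) * opF q A) := by
  have h1 : mulX p 1 * divDiff h * mulX q j
      = mulX (Equiv.swap p r q) j * (mulX p 1 * divDiff h)
        + LinearMap.mulLeft ℂ (xpow p 1 * divDiff h (xpow q j)) := by
    rw [mul_assoc, divDiff_mul_mulX, mul_add, ← mul_assoc, (mulX_commute _ _ _ _).eq, mul_assoc,
      ← mulLeft_mul_mulLeft]
    rfl
  rw [opRefl_of_ne h, opX, opX, opF_apply, opF_apply, opP, opMul_apply]
  simp only [op_mul, ← Module.End.one_eq_id, one_mul, mul_one]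
  rw [← tensPerm_mul_factorOp, h1]
  exact op_add_left _ _ _ _

variable [LieRingModule (Affine m) V] [LieModule ℂ (Affine m) V]

theorem opEuler_affAction (p : Fin N) (A : Mat m) (j : ℕ) :
    opEuler p * affAction (cur A (-(j : ℤ))) - affAction (cur A (-(j : ℤ))) * opEuler p
      = (-(j : ℂ)) • (opX p (-(j : ℤ)) * opF p A : Module.End ℂ (W N m V)) := by
  have h1 : ∀ q, (opEuler p * (opX q (-(j : ℤ)) * opF q A)
      - opX q (-(j : ℤ)) * opF q A * opEuler p : Module.End ℂ (W N m V))
      = if q = p then (-(j : ℂ)) • (opX q (-(j : ℤ)) * opF q A) else 0 := by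
    intro q
    rw [← mul_assoc, opEuler_mul_opX, add_mul, mul_assoc, (opEuler_commute_opF p q A).eq, mul_assoc,
      add_sub_cancel_left, smul_mul_assoc, ite_smul, zero_smul]
    push_cast
    rfl
  rw [affAction_cur_eq, mul_add, add_mul, opCur_apply, (opEuler_commute_opV p _).eq,
    add_sub_add_right_eq_sub, Finset.mul_sum, Finset.sum_mul, ← Finset.sum_sub_distrib,
    Finset.sum_congr rfl fun q _ => h1 q, Finset.sum_ite_eq' Finset.univ p,
    if_pos (Finset.mem_univ p)]

theorem opRefl_affAction {p r : Fin N} (h : r ≠ p) (A : Mat m) (j : ℕ) :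
    opRefl p r * affAction (cur A (-(j : ℤ))) - affAction (cur A (-(j : ℤ))) * opRefl p r
      = ∑ b ∈ Finset.range j, opX p (-(b : ℤ)) * opX r ((b : ℤ) - j)
          * (opP (Equiv.swap p r) * opF r A - opF r A * opP (Equiv.swap p r)
            : Module.End ℂ (W N m V)) := by
  have hrest : ∀ q ∈ (Finset.univ.erase p).erase r,
      (opRefl p r * (opX q (-(j : ℤ)) * opF q A) : Module.End ℂ (W N m V))
        = opX q (-(j : ℤ)) * opF q A * opRefl p r := by
    intro q hq
    have hr := Finset.ne_of_mem_erase hq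
    have hp := Finset.ne_of_mem_erase (Finset.mem_of_mem_erase hq)
    exact ((opRefl_commute_opX hp hr _).mul_right (opRefl_commute_opF hp hr A)).eq
  have hr : r ∈ Finset.univ.erase p := Finset.mem_erase.mpr ⟨h, Finset.mem_univ r⟩
  have hP : (opF r A * opP (Equiv.swap p r) : Module.End ℂ (W N m V))
      = opP (Equiv.swap p r) * opF p A := by
    rw [opP_mul_opF, Equiv.swap_apply_left]
  -- The main terms at sites `p` and `r` are exchanged and cancel. The errors carry opposite divided
  -- differences, so by `hP` they combine into the commutator of the flip with `A^(r)`.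
  have hd : (opMul (xpow p 1 * divDiff h (xpow p (-(j : ℤ)))) : Module.End ℂ (W N m V))
      = -opMul (xpow p 1 * divDiff h (xpow r (-(j : ℤ)))) := by
    rw [divDiff_xpow_right, mul_neg, map_neg, neg_neg]
  rw [affAction_cur_eq, mul_add, add_mul, opCur_apply, (opRefl_commute_opV p r _).eq,
    add_sub_add_right_eq_sub, ← Finset.add_sum_erase _ _ (Finset.mem_univ p),
    ← Finset.add_sum_erase _ _ hr, ← Finset.sum_mul, ← opMul_divDiff h, hP]
  simp only [mul_add, add_mul]
  rw [Finset.mul_sum, Finset.sum_mul, Finset.sum_congr rfl hrest, opRefl_mul_opX_opF h,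
    opRefl_mul_opX_opF h, Equiv.swap_apply_left, Equiv.swap_apply_right, hd, mul_sub, neg_mul]
  abel

theorem gapTerm_mul_opX_opF_of_ne {p q : Fin N} (h : q ≠ p) (i : ℕ) (j : ℤ) (A : Mat m) :
    (gapTerm p i * (opX q j * opF q A) : Module.End ℂ (W N m V))
      = opX q j * opF q A * gapTerm p i := by
  have h1 : Commute (opX p (-(i : ℤ)) : Module.End ℂ (W N m V)) (opX q j * opF q A) :=
    (opX_commute p q _ _).mul_right (opX_commute_opF p q _ A)
  have h2 : Commute (omega p i : Module.End ℂ (W N m V)) (opX q j * opF q A) :=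
    (omega_commute_opX p q _ _).mul_right (omega_commute_opF h.symm _ A)
  rw [gapTerm_eq]
  exact (h1.mul_left h2).eq

theorem gapTerm_mul_opX_opF_sub (p : Fin N) (i : ℕ) (j : ℤ) (A : Mat m) :
    (gapTerm p i * (opX p j * opF p A) - opX p j * opF p A * gapTerm p i
      : Module.End ℂ (W N m V))
      = opX p (-(i : ℤ) + j) * (omega p i * opF p A - opF p A * omega p i) := by
  have h1 : (gapTerm p i * (opX p j * opF p A) : Module.End ℂ (W N m V))
      = opX p (-(i : ℤ) + j) * (omega p i * opF p A) := by
    rw [gapTerm_eq, opX_add, mul_assoc, mul_assoc, ← mul_assoc (omega p (i : ℤ)),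
      (omega_commute_opX p p (i : ℤ) j).eq, mul_assoc]
  have h2 : (opX p j * opF p A * gapTerm p i : Module.End ℂ (W N m V))
      = opX p (-(i : ℤ) + j) * (opF p A * omega p i) := by
    rw [gapTerm_eq, add_comm, opX_add, mul_assoc, mul_assoc, ← mul_assoc (opF p A),
      ← (opX_commute_opF p p (-(i : ℤ)) A).eq, mul_assoc]
  rw [h1, h2, mul_sub]

theorem gapTerm_mul_opCur_sub (p : Fin N) (A : Mat m) (i j : ℕ) :
    (gapTerm p i * opCur N (-(j : ℤ)) A - opCur N (-(j : ℤ)) A * gapTerm p i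
        : Module.End ℂ (W N m V))
      = -(opX p (-(i : ℤ))
            * (omega p ((i : ℤ) - j) * opF p A - opF p A * omega p ((i : ℤ) - j)))
        + (if i = j then (j : ℂ) else 0) • (opX p (-(j : ℤ)) * (opF p A * opV N (cen m))) := by
  have h1 := opCur_mul_omega_sub (N := N) (V := V) p i (-(j : ℤ)) A
  have h2 : opCur N (-(j : ℤ)) A * gapTerm p i
      = (opX p (-(i : ℤ)) * (opCur N (-(j : ℤ)) A * omega p i) : Module.End ℂ (W N m V)) := by
    rw [gapTerm_eq, ← mul_assoc, opCur_apply, (opV_commute_opX _ p _).eq, mul_assoc]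
  have h3 : (-(if -(j : ℤ) = -(i : ℤ) then ((-(j : ℤ) : ℤ) : ℂ) else 0))
      = if i = j then (j : ℂ) else 0 := by
    rcases eq_or_ne i j with rfl | hij
    · simp
    · rw [if_neg hij, if_neg (by omega), neg_zero]
  have h4 : (opX p (-(i : ℤ)) * ((if i = j then (j : ℂ) else 0) • (opF p A * opV N (cen m)))
        : Module.End ℂ (W N m V))
      = (if i = j then (j : ℂ) else 0) • (opX p (-(j : ℤ)) * (opF p A * opV N (cen m))) := by
    rcases eq_or_ne i j with rfl | hij
    · rw [mul_smul_comm]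
    · rw [if_neg hij, zero_smul, zero_smul, mul_zero]
  rw [h2, gapTerm_eq, mul_assoc, ← mul_sub, ← neg_sub, h1, neg_add, ← neg_smul, h3, mul_add, h4,
    mul_neg, neg_add_eq_sub (j : ℤ) (i : ℤ)]

/-- Site `p` and the action on `V` produce the same commutator, with exponents shifted by `j` and
with opposite signs; this makes the sum over `i` telescope. The central term occurs only at `i = j`.
-/
theorem gapTerm_affAction (p : Fin N) (A : Mat m) (i j : ℕ) :
    gapTerm p i * affAction (cur A (-(j : ℤ))) - affAction (cur A (-(j : ℤ))) * gapTerm p i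
      = opX p (-(i : ℤ) + -j) * (omega p i * opF p A - opF p A * omega p i)
        - opX p (-(i : ℤ))
            * (omega p ((i : ℤ) - j) * opF p A - opF p A * omega p ((i : ℤ) - j))
        + (if i = j then (j : ℂ) else 0) •
          (opX p (-(j : ℤ)) * (opF p A * opV N (cen m)) : Module.End ℂ (W N m V)) := by
  have hrest : ∀ q ∈ Finset.univ.erase p,
      (gapTerm p i * (opX q (-(j : ℤ)) * opF q A) : Module.End ℂ (W N m V))
        = opX q (-(j : ℤ)) * opF q A * gapTerm p i := fun q hq =>
    gapTerm_mul_opX_opF_of_ne (Finset.ne_of_mem_erase hq) i _ A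
  rw [affAction_cur_eq, ← Finset.add_sum_erase _ _ (Finset.mem_univ p),
    ← gapTerm_mul_opX_opF_sub p i (-(j : ℤ)) A, sub_eq_add_neg _ (opX p (-(i : ℤ)) * _),
    add_assoc (gapTerm p i * _ - _),
    ← gapTerm_mul_opCur_sub p A i j, mul_add, mul_add, add_mul, add_mul, Finset.mul_sum,
    Finset.sum_mul, Finset.sum_congr rfl hrest]
  abel

theorem gap_affAction (hV : IsSmooth m V) (p : Fin N) (A : Mat m) (j : ℕ) :
    gap hV p * affAction (cur A (-(j : ℤ))) - affAction (cur A (-(j : ℤ))) * gap hV p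
      = -∑ i ∈ Finset.range j, opX p (-(i : ℤ))
            * (omega p ((i : ℤ) - j) * opF p A - opF p A * omega p ((i : ℤ) - j))
        + (j : ℂ) • (opX p (-(j : ℤ)) * (opF p A * opV N (cen m)) : Module.End ℂ (W N m V)) := by
  refine LinearMap.ext fun w => ?_
  obtain ⟨n, hn⟩ := Filter.eventually_atTop.mp ((omega_eventually_zero hV p w).and
    ((omega_eventually_zero hV p (affAction (cur A (-(j : ℤ))) w)).and
      (omega_eventually_zero hV p (opF p A w))))
  -- The central term sits at `i = j`, and the increment keeps `j` below the cutoff `n' + j` even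
  -- when `n = 0`.
  set n' := n + 1
  have h1 : ∀ k : ℕ, n' + j ≤ k → omega p k w = 0 := fun k hk => (hn k (by omega)).1
  have h2 : ∀ k : ℕ, n' + j ≤ k → omega p k (affAction (cur A (-(j : ℤ))) w) = 0 :=
    fun k hk => (hn k (by omega)).2.1
  -- `H` is indexed by the exponent of `ω_p`, so the two commutators in the `i`-th term are `H i`
  -- and `H (i - j)`.
  set H : ℤ → W N m V := fun k =>
    (opX p (-k + -j) * (omega p k * opF p A - opF p A * omega p k) : Module.End ℂ (W N m V)) w with hH
  have hH0 : ∀ k : ℕ, n' ≤ k → H k = 0 := by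
    intro k hk
    have hk' := hn k (by omega)
    simp only [hH, Module.End.mul_apply, LinearMap.sub_apply, hk'.1, hk'.2.2, map_zero, sub_zero]
  have h3 : ∀ i : ℕ, opX p (-(i : ℤ)) (omega p i (affAction (cur A (-(j : ℤ))) w))
      - affAction (cur A (-(j : ℤ))) (opX p (-(i : ℤ)) (omega p i w))
      = H i - H (i - j) + (if i = j then (j : ℂ) else 0) •
          (opX p (-(j : ℤ)) * (opF p A * opV N (cen m)) : Module.End ℂ (W N m V)) w := by
    intro i
    have := LinearMap.congr_fun (gapTerm_affAction (V := V) p A i j) w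
    have e1 : -((i : ℤ) - j) + -j = -i := by ring
    simp only [hH, e1]
    rw [gapTerm_eq] at this
    exact this
  have hj : j ∈ Finset.range (n' + j) := Finset.mem_range.mpr (by omega)
  rw [LinearMap.sub_apply, Module.End.mul_apply, Module.End.mul_apply, gap_eq_sum h1,
    gap_eq_sum h2, map_sum, ← Finset.sum_sub_distrib, Finset.sum_congr rfl fun i _ => h3 i,
    Finset.sum_add_distrib, sum_range_sub_shift H j n' hH0, ← Finset.sum_smul,
    Finset.sum_ite_eq' _ j, if_pos hj, LinearMap.add_apply, LinearMap.neg_apply,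
    LinearMap.sum_apply, LinearMap.smul_apply]
  congr 2
  refine Finset.sum_congr rfl fun i _ => ?_
  have e1 : -((i : ℤ) - j) + -j = -i := by ring
  simp only [hH, e1]

theorem cherednikOp_commute_affAction (κ : ℂ) (hV : IsSmooth m V) (p : Fin N) (A : Mat m) :
    Commute (cherednikOp κ hV p) (affAction (cur A 0)) := by
  have h1 := opEuler_affAction (V := V) p A 0
  have h2 : ∀ r, (opRefl p r * affAction (cur A 0) - affAction (cur A 0) * opRefl p r
      : Module.End ℂ (W N m V)) = 0 := by
    intro r
    rcases eq_or_ne r p with rfl | h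
    · rw [opRefl_self, zero_mul, mul_zero, sub_zero]
    · simpa using opRefl_affAction (V := V) h A 0
  have h3 := gap_affAction hV p A 0
  simp only [Nat.cast_zero, neg_zero, zero_smul, Finset.range_zero, Finset.sum_empty,
    add_zero] at h1 h3
  rw [cherednikOp_eq]
  refine Commute.add_left (Commute.add_left (Commute.smul_left (sub_eq_zero.mp h1) κ) ?_)
    (sub_eq_zero.mp h3)
  exact Commute.sum_left _ _ _ fun r _ => sub_eq_zero.mp (h2 r)

/-- The loop element is split by where it acts. At a site `r ≠ p` the matrix units assemble into the
flip; at `p` one gets `∑ [E_ba, A] E_ab = tr(A) - m A`; on `V`, Casimir invariance gives the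
commutator of `ω_p(k)` with `A^(p)`. -/
theorem sum_affAction_mul (p : Fin N) (A : Mat m) (hA : Matrix.trace A = 0) (i k : ℤ) :
    ∑ a, ∑ b, affAction (cur (E b a * A - A * E b a) k) * (opX p i * opF p (E a b))
      = ∑ r ∈ Finset.univ.erase p, opX p i * opX r k
            * (opP (Equiv.swap p r) * opF r A - opF r A * opP (Equiv.swap p r))
        - (m : ℂ) • (opX p (i + k) * opF p A)
        - opX p i * (omega p k * opF p A - opF p A * omega p k : Module.End ℂ (W N m V)) := by
  have hcur : ∑ a, ∑ b, opCur N k (E b a * A - A * E b a) * (opX p i * opF p (E a b))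
      = -(opX p i * (omega p k * opF p A - opF p A * omega p k : Module.End ℂ (W N m V))) := by
    have hV : ∀ b a : Fin m, Commute (opV N (cur (A * E b a - E b a * A) k))
        (opX p i * opF p (E a b) : Module.End ℂ (W N m V)) := fun b a =>
      (opV_commute_opX _ p i).mul_right (opV_commute_opF _ p _)
    rw [omega_mul_opF_sub, Finset.mul_sum, ← Finset.sum_neg_distrib]
    refine Finset.sum_congr rfl fun a _ => ?_
    rw [Finset.mul_sum, ← Finset.sum_neg_distrib]
    refine Finset.sum_congr rfl fun b _ => ?_
    rw [← neg_sub (A * E b a), map_neg, neg_mul, opCur_apply,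
      (hV b a).eq, mul_assoc]
  have hself : ∑ a, ∑ b, opX p k * opF p (E b a * A - A * E b a) * (opX p i * opF p (E a b))
      = -((m : ℂ) • (opX p (i + k) * opF p A) : Module.End ℂ (W N m V)) := by
    have h1 : ∀ a b : Fin m,
        (opX p k * opF p (E b a * A - A * E b a) * (opX p i * opF p (E a b))
          : Module.End ℂ (W N m V))
        = opX p (i + k) * opF p (E b a * A * E a b - A * (E b a * E a b)) := by
      intro a b
      rw [← mul_assoc A, ← sub_mul, opF_mul, mul_assoc, ← mul_assoc (opF p _) (opX p i),
        ← (opX_commute_opF p p i _).eq, add_comm, opX_add]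
      simp only [mul_assoc]
    simp only [h1, ← Finset.mul_sum, ← map_sum, Finset.sum_sub_distrib]
    rw [sum_E_mul_mul_E, sum_E_mul_E, hA, zero_smul, zero_sub, mul_smul_comm, mul_one, map_neg,
      map_smul, mul_neg, mul_smul_comm]
  have hother : ∀ r ∈ Finset.univ.erase p,
      ∑ a, ∑ b, opX r k * opF r (E b a * A - A * E b a) * (opX p i * opF p (E a b))
      = opX p i * opX r k * (opP (Equiv.swap p r) * opF r A - opF r A * opP (Equiv.swap p r)
          : Module.End ℂ (W N m V)) := by
    intro r hr
    have h := Finset.ne_of_mem_erase hr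
    rw [opP_swap h, Finset.mul_sum, Finset.sum_mul, ← Finset.sum_sub_distrib, Finset.mul_sum]
    refine Finset.sum_congr rfl fun a _ => ?_
    rw [Finset.mul_sum, Finset.sum_mul, ← Finset.sum_sub_distrib, Finset.mul_sum]
    refine Finset.sum_congr rfl fun b _ => ?_
    rw [mul_assoc (opF p _), ← opF_mul, ← mul_assoc (opF r A), ← (opF_commute h.symm _ A).eq,
      mul_assoc (opF p _), ← opF_mul, ← mul_sub, ← map_sub, mul_assoc (opX r k),
      ← mul_assoc (opF r _), ← (opX_commute_opF p r i _).eq, (opF_commute h.symm _ _).eq,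
      mul_assoc (opX p i) (opF r _), ← mul_assoc (opX r k), (opX_commute r p k i).eq]
  simp only [affAction_cur_eq, add_mul, Finset.sum_mul, Finset.sum_add_distrib, hcur]
  have hcomm : ∀ F : Fin m → Fin m → Fin N → Module.End ℂ (W N m V),
      ∑ a, ∑ b, ∑ r, F a b r = ∑ r, ∑ a, ∑ b, F a b r := by
    intro F
    rw [Finset.sum_comm (γ := Fin N)]
    refine Finset.sum_congr rfl fun a _ => Finset.sum_comm
  rw [hcomm, ← Finset.add_sum_erase _ _ (Finset.mem_univ p), hself, Finset.sum_congr rfl hother]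
  abel

/-- Each term on the right has an element of `q` outermost, which is what invariance of `q W` needs.
Both sides are reduced to flip commutators, commutators with `ω_p(i - j)`, and a multiple of
`x_p^{-j} A^(p)`. -/
theorem cherednikOp_affAction (κ : ℂ) (hV : IsSmooth m V) (hl : HasLevel m V (κ - m)) (p : Fin N)
    (A : Mat m) (hA : Matrix.trace A = 0) (j : ℕ) :
    cherednikOp κ hV p * affAction (cur A (-(j : ℤ)))
        - affAction (cur A (-(j : ℤ))) * cherednikOp κ hV p
      = ∑ i ∈ Finset.range j, ∑ a, ∑ b,
          affAction (cur (E b a * A - A * E b a) ((i : ℤ) - j))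
            * (opX p (-(i : ℤ)) * opF p (E a b)) := by
  have hC : (opV N (cen m) : Module.End ℂ (W N m V)) = (κ - m) • 1 :=
    W.hom_ext fun f g v => by rw [opV_tmul, hl, W.tmul_smul]; rfl
  have hR : ∑ r, (opRefl p r * affAction (cur A (-(j : ℤ)))
        - affAction (cur A (-(j : ℤ))) * opRefl p r : Module.End ℂ (W N m V))
      = ∑ r ∈ Finset.univ.erase p, ∑ b ∈ Finset.range j, opX p (-(b : ℤ)) * opX r ((b : ℤ) - j)
          * (opP (Equiv.swap p r) * opF r A - opF r A * opP (Equiv.swap p r)) := by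
    rw [← Finset.add_sum_erase _ _ (Finset.mem_univ p), opRefl_self, zero_mul, mul_zero, sub_zero,
      zero_add]
    exact Finset.sum_congr rfl fun r hr => opRefl_affAction (Finset.ne_of_mem_erase hr) A j
  have hsum : ∀ i : ℕ, -(i : ℤ) + (i - j) = -j := fun i => by ring
  have hE := opEuler_affAction (V := V) p A j
  have hG := gap_affAction hV p A j
  rw [hC, mul_smul_comm, mul_one, mul_smul_comm] at hG
  simp only [sum_affAction_mul p A hA, Finset.sum_sub_distrib, hsum, Finset.sum_const,
    Finset.card_range]
  rw [Finset.sum_comm, ← hR, cherednikOp_eq, Finset.sum_sub_distrib, ← Finset.mul_sum,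
    ← Finset.sum_mul]
  have e : (κ • opEuler p + ∑ r, opRefl p r + gap hV p) * affAction (cur A (-(j : ℤ)))
      - affAction (cur A (-(j : ℤ))) * (κ • opEuler p + ∑ r, opRefl p r + gap hV p)
      = κ • (opEuler p * affAction (cur A (-(j : ℤ)))
          - affAction (cur A (-(j : ℤ))) * opEuler p)
        + ((∑ r, opRefl p r) * affAction (cur A (-(j : ℤ)))
          - affAction (cur A (-(j : ℤ))) * ∑ r, opRefl p r)
        + (gap hV p * affAction (cur A (-(j : ℤ)))
          - affAction (cur A (-(j : ℤ))) * gap hV p : Module.End ℂ (W N m V)) := by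
    rw [smul_sub, ← smul_mul_assoc, ← mul_smul_comm]
    simp only [add_mul, mul_add]
    abel
  -- The coefficients of `x_p^{-j} A^(p)` agree as `-κ j + (κ - m) j = -m j`: this is where the
  -- level is forced.
  rw [e, hE, hG, ← Nat.cast_smul_eq_nsmul ℂ]
  module

end AffineCommutator

/-! ### The action of the trigonometric Cherednik algebra -/

section Representation

variable {N m : ℕ} {V : Type*} [AddCommGroup V] [Module ℂ V]
variable [LieRingModule (Affine m) V] [LieModule ℂ (Affine m) V]

/-- The operators by which the generators act on `W`. -/
def genAction (κ : ℂ) (hV : IsSmooth m V) : Gen N → Module.End ℂ (W N m V)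
  | Gen.perm σ => opS σ
  | Gen.x p => opX p 1
  | Gen.xInv p => opX p (-1)
  | Gen.u p => cherednikOp κ hV p + jucysMurphy opS p

theorem lift_z (κ : ℂ) (hV : IsSmooth m V) (p : Fin N) :
    FreeAlgebra.lift ℂ (genAction κ hV) (Pre.z p) = cherednikOp κ hV p := by
  simp only [Pre.z, Pre.u, Pre.s, map_sub, map_sum, FreeAlgebra.lift_ι_apply, genAction]
  exact add_sub_cancel_right _ _

theorem lift_genAction_rel (κ : ℂ) (hV : IsSmooth m V) {a b : FreeAlgebra ℂ (Gen N)}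
    (h : Rel N κ a b) :
    FreeAlgebra.lift ℂ (genAction κ hV) a = FreeAlgebra.lift ℂ (genAction κ hV) b := by
  have hs : ∀ σ : Equiv.Perm (Fin N),
      FreeAlgebra.lift ℂ (genAction κ hV) (Pre.s σ) = opS σ := fun _ =>
    FreeAlgebra.lift_ι_apply _ _
  have hx : ∀ p : Fin N, FreeAlgebra.lift ℂ (genAction κ hV) (Pre.x p) = opX p 1 := fun _ =>
    FreeAlgebra.lift_ι_apply _ _
  have hxi : ∀ p : Fin N, FreeAlgebra.lift ℂ (genAction κ hV) (Pre.xInv p) = opX p (-1) := fun _ =>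
    FreeAlgebra.lift_ι_apply _ _
  have hu : ∀ p : Fin N, FreeAlgebra.lift ℂ (genAction κ hV) (Pre.u p)
      = cherednikOp κ hV p + jucysMurphy opS p := fun _ => FreeAlgebra.lift_ι_apply _ _
  have hsz := opS_mul_cherednikOp (N := N) κ hV
  induction h with
  | perm_one => rw [hs, map_one, opS_one]
  | perm_mul σ τ => rw [map_mul, hs, hs, hs, opS_mul]
  | x_comm p q => rw [map_mul, map_mul, hx, hx, (opX_commute p q 1 1).eq]
  | x_mul_xInv p => rw [map_mul, hx, hxi, map_one, ← opX_add, add_neg_cancel, opX_zero]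
  | xInv_mul_x p => rw [map_mul, hx, hxi, map_one, ← opX_add, neg_add_cancel, opX_zero]
  | u_comm p q =>
    rw [map_mul, map_mul, hu, hu]
    exact add_jucysMurphy_commute opS_mul hsz
      (fun _ _ h => cherednikOp_commutator κ hV h) p q
  | perm_u_far p p' q hp hq hq' =>
    rw [map_mul, map_mul, hu, hs]
    exact perm_mul_far opS_mul hsz hp hq hq'
  | perm_u_near p p' hp =>
    rw [map_sub, map_mul, map_mul, hu, hu, hs, map_one]
    exact perm_mul_near opS_mul opS_one hsz hp
  | perm_x σ p =>
    rw [map_mul, map_mul, hs, hs, hx, hx, opS_mul_opX, mul_assoc, ← opS_mul, mul_inv_cancel,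
      opS_one, mul_one]
  | z_x_ne p q h =>
    rw [map_sub, map_mul, map_mul, map_neg, map_mul, lift_z, hx, hx, hs]
    exact cherednikOp_mul_opX_of_ne κ hV h
  | z_x_self p =>
    simp only [map_sub, map_mul, map_add, map_smul, map_sum, lift_z, hx, hs]
    exact cherednikOp_mul_opX_self κ hV p

/-- The representation of the trigonometric Cherednik algebra on `W`. -/
def rep (N : ℕ) (κ : ℂ) (hV : IsSmooth m V) : Alg N κ →ₐ[ℂ] Module.End ℂ (W N m V) :=
  RingQuot.liftAlgHom ℂ ⟨FreeAlgebra.lift ℂ (genAction κ hV),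
    fun _ _ h => lift_genAction_rel κ hV h⟩

theorem rep_mkAlgHom (κ : ℂ) (hV : IsSmooth m V) (a : FreeAlgebra ℂ (Gen N)) :
    rep N κ hV (RingQuot.mkAlgHom ℂ (Rel N κ) a) = FreeAlgebra.lift ℂ (genAction κ hV) a :=
  RingQuot.liftAlgHom_mkAlgHom_apply _ _ _ _

/-- A subalgebra containing all `x_p^{±1}`, permutations and Cherednik operators contains the image
of the trigonometric Cherednik algebra. -/
theorem rep_mem (κ : ℂ) (hV : IsSmooth m V) (S : Subalgebra ℂ (Module.End ℂ (W N m V)))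
    (hs : ∀ σ, opS σ ∈ S) (hx : ∀ p j, opX p j ∈ S) (hz : ∀ p, cherednikOp κ hV p ∈ S)
    (a : Alg N κ) : rep N κ hV a ∈ S := by
  obtain ⟨a, rfl⟩ := RingQuot.mkAlgHom_surjective ℂ (Rel N κ) a
  rw [rep_mkAlgHom]
  induction a using FreeAlgebra.induction with
  | grade0 r => rw [AlgHom.commutes]; exact S.algebraMap_mem r
  | grade1 g =>
    rw [FreeAlgebra.lift_ι_apply]
    cases g with
    | perm σ => exact hs σ
    | x p => exact hx p 1
    | xInv p => exact hx p (-1)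
    | u p => exact S.add_mem (hz p) (S.sum_mem fun _ _ => hs _)
  | mul a b ha hb => rw [map_mul]; exact S.mul_mem ha hb
  | add a b ha hb => rw [map_add]; exact S.add_mem ha hb

theorem affAction_cur_commute_opX (A : Mat m) (j : ℤ) (p : Fin N) (i : ℤ) :
    Commute (opX p i : Module.End ℂ (W N m V)) (affAction (cur A j)) := by
  rw [affAction_cur_eq]
  exact (Commute.sum_right _ _ _ fun q _ =>
    (opX_commute p q i j).mul_right (opX_commute_opF p q i A)).add_right
      (opV_commute_opX _ p i).symm

theorem affAction_cur_commute_opS (A : Mat m) (j : ℤ) (σ : Equiv.Perm (Fin N)) :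
    Commute (opS σ : Module.End ℂ (W N m V)) (affAction (cur A j)) := by
  rw [affAction_cur_eq]
  refine Commute.add_right ?_ (opV_commute_opS _ σ).symm
  rw [Commute, SemiconjBy, Finset.mul_sum, Finset.sum_mul]
  refine Finset.sum_equiv σ (by simp) fun q _ => ?_
  rw [← mul_assoc, opS_mul_opX, mul_assoc, opS_mul_opF, mul_assoc]

theorem affAction_mem_qW {Z : Affine m} (hZ : Z ∈ q m) (w : W N m V) :
    affAction Z w ∈ qW N m V := Submodule.subset_span ⟨Z, hZ, w, rfl⟩

theorem cur_mem_q {A : Mat m} (hA : Matrix.trace A = 0) {j : ℤ} (hj : j < 0) : cur A j ∈ q m :=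
  Submodule.subset_span ⟨A, j, hA, hj, rfl⟩

/-- An operator preserves `q W` if its commutators with the generators of `q` map `W` to `q W`. -/
theorem qW_invariant {φ : Module.End ℂ (W N m V)}
    (h : ∀ (A : Mat m) (j : ℤ), Matrix.trace A = 0 → j < 0 → ∀ w,
      (φ * affAction (cur A j) - affAction (cur A j) * φ : Module.End ℂ (W N m V)) w ∈ qW N m V) :
    qW N m V ≤ (qW N m V).comap φ := by
  refine Submodule.span_le.mpr ?_
  rintro _ ⟨Z, hZ, w, rfl⟩
  rw [SetLike.mem_coe, Submodule.mem_comap]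
  refine Submodule.span_induction (p := fun Z _ => φ (affAction Z w) ∈ qW N m V) ?_ ?_ ?_ ?_ hZ
  · rintro _ ⟨A, j, hA, hj, rfl⟩
    have := add_mem (h A j hA hj w) (affAction_mem_qW (cur_mem_q hA hj) (φ w))
    rwa [LinearMap.sub_apply, Module.End.mul_apply, Module.End.mul_apply, sub_add_cancel] at this
  · rw [map_zero, LinearMap.zero_apply, map_zero]
    exact zero_mem _
  · intro Z Z' _ _ hZ hZ'
    rw [map_add, LinearMap.add_apply, map_add]
    exact add_mem hZ hZ'
  · intro c Z _ hZ
    rw [map_smul, LinearMap.smul_apply, map_smul]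
    exact Submodule.smul_mem _ _ hZ

theorem qW_invariant_of_commute {φ : Module.End ℂ (W N m V)}
    (h : ∀ (A : Mat m) (j : ℤ), Commute φ (affAction (cur A j))) :
    qW N m V ≤ (qW N m V).comap φ :=
  qW_invariant fun A j _ _ w => by
    rw [(h A j).eq, sub_self, LinearMap.zero_apply]
    exact zero_mem _

theorem qW_invariant_cherednikOp (κ : ℂ) (hV : IsSmooth m V) (hl : HasLevel m V (κ - m))
    (p : Fin N) : qW N m V ≤ (qW N m V).comap (cherednikOp κ hV p) := by
  refine qW_invariant fun A j hA hj w => ?_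
  obtain ⟨n, rfl⟩ : ∃ n : ℕ, j = -(n : ℤ) := ⟨j.natAbs, by omega⟩
  rw [cherednikOp_affAction κ hV hl p A hA n]
  simp only [LinearMap.sum_apply]
  refine Submodule.sum_mem _ fun i hi => Submodule.sum_mem _ fun a _ =>
    Submodule.sum_mem _ fun b _ => ?_
  have hi' := Finset.mem_range.mp hi
  rw [Module.End.mul_apply]
  -- Here `i < n` makes the exponent `i - n` negative, and the matrix is a commutator, hence
  -- traceless.
  refine affAction_mem_qW (cur_mem_q ?_ (by omega)) _
  rw [Matrix.trace_sub, Matrix.trace_mul_comm, sub_self]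

end Representation

end TrigCherednik

end

theorem proposition1p5 (N m : ℕ) (κ : ℂ) (V : Type*) [AddCommGroup V] [Module ℂ V]
    [LieRingModule (TrigCherednik.Affine m) V] [LieModule ℂ (TrigCherednik.Affine m) V]
    (hV : TrigCherednik.IsSmooth m V) :
    ∃ ρ : TrigCherednik.Alg N κ →ₐ[ℂ] Module.End ℂ (TrigCherednik.W N m V),
      (∀ p : Fin N, ρ (TrigCherednik.Alg.x κ p)
        = TrigCherednik.op (TrigCherednik.mulX p 1) LinearMap.id LinearMap.id) ∧
      (∀ p : Fin N, ρ (TrigCherednik.Alg.xInv κ p)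
        = TrigCherednik.op (TrigCherednik.mulX p (-1)) LinearMap.id LinearMap.id) ∧
      (∀ σ : Equiv.Perm (Fin N), ρ (TrigCherednik.Alg.s κ σ)
        = TrigCherednik.op (TrigCherednik.varPerm σ).toLinearMap (TrigCherednik.tensPerm m σ)
            LinearMap.id) ∧
      (∀ p : Fin N, ρ (TrigCherednik.Alg.z κ p) = TrigCherednik.cherednikOp κ hV p) ∧
      (∀ (a : TrigCherednik.Alg N κ) (X : TrigCherednik.Mat m),
        Commute (ρ a) (TrigCherednik.affAction (TrigCherednik.cur X 0))) ∧
      (TrigCherednik.HasLevel m V (κ - m) →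
        ∀ (a : TrigCherednik.Alg N κ), ∀ w ∈ TrigCherednik.qW N m V,
          ρ a w ∈ TrigCherednik.qW N m V) := by
  refine ⟨TrigCherednik.rep N κ hV, fun p => ?_, fun p => ?_, fun σ => ?_, fun p => ?_,
    fun a X => ?_, fun hl a w hw => ?_⟩
  · exact (TrigCherednik.rep_mkAlgHom κ hV _).trans (FreeAlgebra.lift_ι_apply _ _)
  · exact (TrigCherednik.rep_mkAlgHom κ hV _).trans (FreeAlgebra.lift_ι_apply _ _)
  · exact (TrigCherednik.rep_mkAlgHom κ hV _).trans (FreeAlgebra.lift_ι_apply _ _)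
  · exact (TrigCherednik.rep_mkAlgHom κ hV _).trans (TrigCherednik.lift_z κ hV p)
  · have h := TrigCherednik.rep_mem κ hV
      (Subalgebra.centralizer ℂ {TrigCherednik.affAction (TrigCherednik.cur X 0)}) ?_ ?_ ?_ a
    · exact ((Subalgebra.mem_centralizer_iff ℂ).mp h _ rfl).symm
    · rintro σ _ rfl
      exact (TrigCherednik.affAction_cur_commute_opS X 0 σ).symm.eq
    · rintro p j _ rfl
      exact (TrigCherednik.affAction_cur_commute_opX X 0 p j).symm.eq
    · rintro p _ rfl
      exact (TrigCherednik.cherednikOp_commute_affAction κ hV p X).symm.eq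
  -- Operators preserving `q W` form a subalgebra, so invariance need only be checked for
  -- permutations, powers of the variables and Cherednik operators.
  · let S : Subalgebra ℂ (Module.End ℂ (TrigCherednik.W N m V)) :=
      { carrier := {φ | ∀ w ∈ TrigCherednik.qW N m V, φ w ∈ TrigCherednik.qW N m V}
        mul_mem' := fun hφ hψ w hw => hφ _ (hψ w hw)
        add_mem' := fun hφ hψ w hw => add_mem (hφ w hw) (hψ w hw)
        algebraMap_mem' := fun c _ hw => Submodule.smul_mem _ c hw }
    exact TrigCherednik.rep_mem κ hV S
      (fun σ w hw => TrigCherednik.qW_invariant_of_commute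
        (fun A j => TrigCherednik.affAction_cur_commute_opS A j σ) hw)
      (fun p i w hw => TrigCherednik.qW_invariant_of_commute
        (fun A j => TrigCherednik.affAction_cur_commute_opX A j p i) hw)
      (fun p w hw => TrigCherednik.qW_invariant_cherednikOp κ hV hl p hw) a w hw
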